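/- Let $N\ge 1$ and let $\gamma$ be a simple, piecewise $C^1$ loop in $\mathbb C$ that starts at the origin, goes once around the point at infinity and returns to the origin. Let $W$ be an $N\times N$ matrix of weights on $\gamma$ of Bessel type: for a continuous branch of $\log$ along $\gamma\setminus\{0\}$, each entry is a finite sum $$W^{(j,k)}(z)=\sum_{m\in I_{j,k}}\varphi_m(z)\,z^{p_m}\log^{q_m}(z)\,e^{-\lambda_m/z},\qquad z\in\gamma\setminus\{0\},$$ with $p_m\in\mathbb C$, $q_m\in\mathbb N=\{0,1,2,\dots\}$, $\operatorname{Re}\lambda_m\ge 0$, and $\varphi_m$ Hölder continuous, bounded and nonvanishing on $\gamma$. Let $W$ be regular: $W$ is integrable on $\gamma$ and its moments $W_n=\int_\gamma z^nW(z)\frac{dz}{2\pi i}$ satisfy $\det[W_{j+k}]_{j,k=0,\dots,n}\neq0$ for all $n\in\mathbb N$. Let $h^{L},h^{R}$ be entire $N\times N$ matrix functions and suppose that $W=W_LW_R$ on $\gamma\setminus\{0\}$, where $W_L,W_R$ are holomorphic and invertible on an open set $U\supseteq\gamma\setminus\{0\}$ (for instance, the plane cut along a curve from $0$ to $\infty$)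 and satisfy on $U$ $$z^2W_L'(z)=h^L(z)W_L(z),\qquad z^2W_R'(z)=W_R(z)h^R(z).$$ Then there are monic $N\times N$ matrix polynomials $P_n^L,P_n^R$ of degree $n$ and nonsingular matrices $C_n$, $n\in\mathbb N$, with $$\int_\gamma P_n^L(z)W(z)z^k\frac{dz}{2\pi i}=\delta_{n,k}C_n^{-1}=\int_\gamma z^kW(z)P_n^R(z)\frac{dz}{2\pi i},\qquad 0\le k\le n .$$ For any such $P_n^L,P_n^R,C_n$, put $Q_n^L(z)=\int_\gamma \frac{P_n^L(t)W(t)}{t-z}\frac{dt}{2\pi i}$, $Q_n^R(z)=\int_\gamma\frac{W(t)P_n^R(t)}{t-z}\frac{dt}{2\pi i}$ and $$Y_n^L=\begin{bmatrix}P_n^L&Q_n^L\\-C_{n-1}P_{n-1}^L&-C_{n-1}Q_{n-1}^L\end{bmatrix},\qquad Y_n^R=\begin{bmatrix}P_n^R&-P_{n-1}^RC_{n-1}\\Q_n^R&-Q_{n-1}^RC_{n-1}\end{bmatrix},$$ where for $n=0$ the second block row of $Y_0^L$ is $(0,I)$ and the second block column of $Y_0^R$ is $(0,I)^{\top}$.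 Let $$Z_n^L=Y_n^L\begin{bmatrix}W_L&0\\0&W_R^{-1}\end{bmatrix},\qquad Z_n^R=\begin{bmatrix}W_R&0\\0&W_L^{-1}\end{bmatrix}Y_n^R .$$ Then, for every $n\in\mathbb N$, $Z_n^L$ and $Z_n^R$ are holomorphic and invertible on $U\setminus\gamma$, and the structure matrices $$M_n^L=(Z_n^L)'(Z_n^L)^{-1},\qquad M_n^R=(Z_n^R)^{-1}(Z_n^R)'$$ extend from $U\setminus\gamma$ to meromorphic matrix functions on $\mathbb C$ that are holomorphic on $\mathbb C\setminus\{0\}$ and have at $z=0$ at most a pole of order $2$; that is, $z^2M_n^L$ and $z^2M_n^R$ extend to entire matrix functions. -/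

import Mathlib

noncomputable section

namespace BesselMBP

/-- Square complex matrices of size `N`. -/
abbrev Mat (N : ℕ) := Matrix (Fin N) (Fin N) ℂ

/-- Complex `2 × 2` block matrices with blocks of size `N`. -/
abbrev BlockMat (N : ℕ) := Matrix (Fin N ⊕ Fin N) (Fin N ⊕ Fin N) ℂ

/-- A piecewise `C¹` simple loop in the complex plane that starts at the origin and returns to it,
parametrized by `[0, 1]`.  Such a loop separates `∞` from its interior, so it goes around `∞`
exactly once; both orientations are allowed. -/
structure OriginLoop where
  toFun : ℝ → ℂ
  map_zero : toFun 0 = 0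
  map_one : toFun 1 = 0
  injOn : Set.InjOn toFun (Set.Ico 0 1)
  piecewise_C1 : ∃ (k : ℕ) (a : ℕ → ℝ), Monotone a ∧ a 0 = 0 ∧ a k = 1 ∧
    ∀ i < k, ContDiffOn ℝ 1 toFun (Set.Icc (a i) (a (i + 1)))

/-- The trace of the loop, as a set of points of the plane (it contains the origin). -/
def OriginLoop.trace (γ : OriginLoop) : Set ℂ := γ.toFun '' Set.Icc 0 1

/-- The normalized contour integral `∫_γ F(z) dz / (2 π i)` of a matrix function, entrywise. -/
def loopIntegral {N : ℕ} (γ : OriginLoop) (F : ℂ → Mat N) : Mat N :=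
  Matrix.of fun j k =>
    (2 * (Real.pi : ℂ) * Complex.I)⁻¹ * ∫ t in (0 : ℝ)..1, F (γ.toFun t) j k * deriv γ.toFun t

/-- A function on the loop is Hölder continuous, bounded and nonvanishing there. -/
def IsAdmissibleFactor (γ : OriginLoop) (φ : ℂ → ℂ) : Prop :=
  (∃ C r : NNReal, 0 < r ∧ r ≤ 1 ∧ HolderOnWith C r φ γ.trace) ∧
    (∃ B : ℝ, ∀ z ∈ γ.trace, ‖φ z‖ ≤ B) ∧ ∀ z ∈ γ.trace, φ z ≠ 0

/-- Matrices of weights of Bessel type on the loop: with a continuous branch `ℓ` of the logarithm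
along the loop (without its base point `0`), each entry is a finite sum of terms
`φ_m(z) z^{p_m} log^{q_m}(z) exp(-λ_m / z)` with `Re λ_m ≥ 0`, where `z^p = exp (p ℓ(z))`. -/
def IsBesselType {N : ℕ} (γ : OriginLoop) (W : ℂ → Mat N) : Prop :=
  ∃ ℓ : ℂ → ℂ, ContinuousOn ℓ (γ.trace \ {0}) ∧ (∀ z ∈ γ.trace \ {0}, Complex.exp (ℓ z) = z) ∧
    ∀ j k : Fin N, ∃ (r : ℕ) (φ : Fin r → ℂ → ℂ) (p : Fin r → ℂ) (q : Fin r → ℕ) (lam : Fin r → ℂ),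
      (∀ m, IsAdmissibleFactor γ (φ m)) ∧ (∀ m, 0 ≤ (lam m).re) ∧
      ∀ z ∈ γ.trace \ {0}, W z j k =
        ∑ m, φ m z * Complex.exp (p m * ℓ z) * ℓ z ^ q m * Complex.exp (-lam m / z)

/-- The `n`-th moment `W_n = ∫_γ zⁿ W(z) dz / (2 π i)`. -/
def moment {N : ℕ} (γ : OriginLoop) (W : ℂ → Mat N) (n : ℕ) : Mat N :=
  loopIntegral γ fun z => z ^ n • W z

/-- The block Hankel matrix `[W_{j+k}]`, `0 ≤ j, k ≤ n`, of the moments. -/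
def hankel {N : ℕ} (γ : OriginLoop) (W : ℂ → Mat N) (n : ℕ) :
    Matrix (Fin (n + 1) × Fin N) (Fin (n + 1) × Fin N) ℂ :=
  Matrix.of fun a b => moment γ W ((a.1 : ℕ) + (b.1 : ℕ)) a.2 b.2

/-- A regular matrix of weights: it is integrable along the loop (so that its moments exist) and
all its block Hankel determinants are nonzero. -/
def IsRegular {N : ℕ} (γ : OriginLoop) (W : ℂ → Mat N) : Prop :=
  (∀ j k, IntervalIntegrable (fun t : ℝ => W (γ.toFun t) j k * deriv γ.toFun t)
    MeasureTheory.volume 0 1) ∧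
  ∀ n : ℕ, (hankel γ W n).det ≠ 0

/-- The value at `z` of a polynomial with matrix coefficients. -/
def polyVal {N : ℕ} (P : Polynomial (Mat N)) (z : ℂ) : Mat N := P.eval (Matrix.scalar (Fin N) z)

/-- `PL`, `PR` are the sequences of left and right orthogonal monic matrix polynomials of the
weight, and `C n` are the nonsingular matrices whose inverses are the norms. -/
structure IsBiorthogonal {N : ℕ} (γ : OriginLoop) (W : ℂ → Mat N)
    (PL PR : ℕ → Polynomial (Mat N)) (C : ℕ → Mat N) : Prop where
  left_monic : ∀ n, (PL n).Monic ∧ (PL n).natDegree = n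
  right_monic : ∀ n, (PR n).Monic ∧ (PR n).natDegree = n
  nonsingular : ∀ n, IsUnit (C n)
  left_orthogonal : ∀ n k, k ≤ n →
    loopIntegral γ (fun z => z ^ k • (polyVal (PL n) z * W z)) = if k = n then (C n)⁻¹ else 0
  right_orthogonal : ∀ n k, k ≤ n →
    loopIntegral γ (fun z => z ^ k • (W z * polyVal (PR n) z)) = if k = n then (C n)⁻¹ else 0

/-- Left function of the second kind, `∫_γ P(t) W(t) / (t - z) dt / (2 π i)`. -/
def secondKindL {N : ℕ} (γ : OriginLoop) (W : ℂ → Mat N) (P : Polynomial (Mat N)) (z : ℂ) : Mat N :=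
  loopIntegral γ fun t => (t - z)⁻¹ • (polyVal P t * W t)

/-- Right function of the second kind, `∫_γ W(t) P(t) / (t - z) dt / (2 π i)`. -/
def secondKindR {N : ℕ} (γ : OriginLoop) (W : ℂ → Mat N) (P : Polynomial (Mat N)) (z : ℂ) : Mat N :=
  loopIntegral γ fun t => (t - z)⁻¹ • (W t * polyVal P t)

/-- The matrix `Y_n^L`.  For `n = 0` the conventions `P_{-1}^L = 0` and
`Q_{-1}^L = -C_{-1}⁻¹` make the second block row `(0, I)`. -/
def YL {N : ℕ} (γ : OriginLoop) (W : ℂ → Mat N) (PL : ℕ → Polynomial (Mat N)) (C : ℕ → Mat N) :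
    ℕ → ℂ → BlockMat N
  | 0, z => Matrix.fromBlocks (polyVal (PL 0) z) (secondKindL γ W (PL 0) z) 0 1
  | n + 1, z => Matrix.fromBlocks
      (polyVal (PL (n + 1)) z) (secondKindL γ W (PL (n + 1)) z)
      (-(C n * polyVal (PL n) z)) (-(C n * secondKindL γ W (PL n) z))

/-- The matrix `Y_n^R`.  For `n = 0` the conventions `P_{-1}^R = 0` and
`Q_{-1}^R = -C_{-1}⁻¹` make the second block column `(0, I)`. -/
def YR {N : ℕ} (γ : OriginLoop) (W : ℂ → Mat N) (PR : ℕ → Polynomial (Mat N)) (C : ℕ → Mat N) :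
    ℕ → ℂ → BlockMat N
  | 0, z => Matrix.fromBlocks (polyVal (PR 0) z) 0 (secondKindR γ W (PR 0) z) 1
  | n + 1, z => Matrix.fromBlocks
      (polyVal (PR (n + 1)) z) (-(polyVal (PR n) z * C n))
      (secondKindR γ W (PR (n + 1)) z) (-(secondKindR γ W (PR n) z * C n))

/-- The fundamental matrix `Z^L = Y^L diag(W_L, W_R⁻¹)`. -/
def ZL {N : ℕ} (Y : ℂ → BlockMat N) (WL WR : ℂ → Mat N) (z : ℂ) : BlockMat N :=
  Y z * Matrix.fromBlocks (WL z) 0 0 (WR z)⁻¹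

/-- The fundamental matrix `Z^R = diag(W_R, W_L⁻¹) Y^R`. -/
def ZR {N : ℕ} (Y : ℂ → BlockMat N) (WL WR : ℂ → Mat N) (z : ℂ) : BlockMat N :=
  Matrix.fromBlocks (WR z) 0 0 (WL z)⁻¹ * Y z

/-- Entrywise complex derivative of a matrix function. -/
def matDeriv {ι : Type} (F : ℂ → Matrix ι ι ℂ) (z : ℂ) : Matrix ι ι ℂ :=
  Matrix.of fun i j => deriv (fun w => F w i j) z

/-- Entrywise complex differentiability of a matrix function at a point. -/
def MatDifferentiableAt {ι : Type} (F : ℂ → Matrix ι ι ℂ) (z : ℂ) : Prop :=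
  ∀ i j, DifferentiableAt ℂ (fun w => F w i j) z

/-- Entire matrix functions. -/
def MatEntire {ι : Type} (F : ℂ → Matrix ι ι ℂ) : Prop :=
  ∀ i j, Differentiable ℂ (fun w => F w i j)

/-- The left structure matrix `Z' Z⁻¹`. -/
def structureL {N : ℕ} (Z : ℂ → BlockMat N) (z : ℂ) : BlockMat N := matDeriv Z z * (Z z)⁻¹

/-- The right structure matrix `Z⁻¹ Z'`. -/
def structureR {N : ℕ} (Z : ℂ → BlockMat N) (z : ℂ) : BlockMat N := (Z z)⁻¹ * matDeriv Z z

/-- `W` factors along the loop as `W_L W_R`, where `W_L` and `W_R` are holomorphic invertible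
solutions of `z² W_L' = h^L W_L` and `z² W_R' = W_R h^R` on an open set `U` that contains the loop
without its base point `0` (typically the plane cut along a curve from `0` to `∞`). -/
structure IsPearsonFactorization {N : ℕ} (γ : OriginLoop) (W : ℂ → Mat N) (hL hR : ℂ → Mat N)
    (U : Set ℂ) (WL WR : ℂ → Mat N) : Prop where
  isOpen : IsOpen U
  trace_subset : γ.trace \ {0} ⊆ U
  left_holomorphic : ∀ z ∈ U, MatDifferentiableAt WL z
  right_holomorphic : ∀ z ∈ U, MatDifferentiableAt WR z
  left_invertible : ∀ z ∈ U, IsUnit (WL z)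
  right_invertible : ∀ z ∈ U, IsUnit (WR z)
  left_pearson : ∀ z ∈ U, z ^ 2 • matDeriv WL z = hL z * WL z
  right_pearson : ∀ z ∈ U, z ^ 2 • matDeriv WR z = WR z * hR z
  factor : ∀ z ∈ γ.trace \ {0}, W z = WL z * WR z

/-- The matrix function `F`, given on `D`, is (the restriction of) a meromorphic function on `ℂ`
whose only possible singularity is a pole of order at most `2` at `0`; equivalently, `z² F(z)`
extends to an entire function. -/
def IsMeromorphicWithDoublePole {ι : Type} (F : ℂ → Matrix ι ι ℂ) (D : Set ℂ) : Prop :=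
  ∃ M E : ℂ → Matrix ι ι ℂ,
    (∀ z ∈ D, M z = F z) ∧
    (∀ i j, MeromorphicOn (fun z => M z i j) Set.univ) ∧
    (∀ z, z ≠ 0 → MatDifferentiableAt M z) ∧
    (∀ i j, ((-2 : ℤ) : WithTop ℤ) ≤ meromorphicOrderAt (fun z => M z i j) 0) ∧
    MatEntire E ∧ ∀ z, z ≠ 0 → E z = z ^ 2 • M z

end BesselMBP

end

noncomputable section

namespace BesselMBP

open MeasureTheory Set Filter Topology

/-! ### Primitives and boundary behaviour on an interval -/

/-! Write `D = diag(W_L, W_R⁻¹)`. The Pearson equations give `z² D' = diag(h^L, -h^R) D`, so `D`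
cancels and `z² M_n^L = (z² Y' + Y diag(h^L, -h^R)) Y⁻¹` with `Y = Y_n^L`. No jump across the loop
is analysed: an entire function is written down that equals this product off the loop.

The inverse is explicit. With `J` the symplectic unit, `Y⁻¹ = -J Y_n^R J`
(`IsBiorthogonal.YL_mul_YR`), because commutators of left and right Cauchy transforms are integrals
of divided differences, which orthogonality evaluates. Every block of the product then involves an
entire `A` from a row of `Y`, an entire `B` from a column of `Y⁻¹`, and their Cauchy transforms.

Integration by parts (`smul_cauchyLDeriv`) rewrites `z²` times the derivative of the transform of
`A` through Cauchy transforms without derivatives. These combine in `structureEntry_eq` into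
integrals of divided differences of entire functions, which are entire in `z`.

The boundary term vanishes because integrability of the weight forces `z² W → 0` at the base point
(`boundary_eq_zero`). The right structure matrix is `J M_n^L J`. Existence of the polynomials comes
from the inverse Hankel matrices. -/

theorem exists_continuousOn_extension {f f' : ℝ → ℂ} {a b : ℝ} (hab : a < b) {s : Set ℝ}
    (hs : s.Countable) (hf : ContinuousOn f (Ioo a b))
    (hd : ∀ x ∈ Ioo a b \ s, HasDerivAt f (f' x) x) (hi : IntervalIntegrable f' volume a b) :
    ∃ F : ℝ → ℂ, ContinuousOn F (Icc a b) ∧ EqOn F f (Ioo a b) := by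
  set m := (a + b) / 2 with hm
  have ham : a < m := by rw [hm]; linarith
  have hmb : m < b := by rw [hm]; linarith
  have hsub : ∀ x ∈ Icc a b, ∀ y ∈ Icc a b, IntervalIntegrable f' volume x y := by
    intro x hx y hy
    refine hi.mono_set ?_
    rw [uIcc_of_le hab.le]
    exact uIcc_subset_Icc hx hy
  -- The primitive is anchored at the midpoint, since nothing is known of `f` at the endpoints.
  refine ⟨fun x => f m + ∫ t in m..x, f' t, ?_, ?_⟩
  · refine continuousOn_const.add ?_
    have := intervalIntegral.continuousOn_primitive_interval' hi
      (a := m) (by rw [uIcc_of_le hab.le]; exact ⟨ham.le, hmb.le⟩)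
    rwa [uIcc_of_le hab.le] at this
  · intro x hx
    have key : ∀ y ∈ Ioo a b, ∀ z ∈ Ioo a b, y ≤ z → ∫ t in y..z, f' t = f z - f y := by
      intro y hy z hz hyz
      refine integral_eq_of_hasDerivAt_off_countable_of_le f f' hyz hs
        (hf.mono fun t ht => ⟨hy.1.trans_le ht.1, ht.2.trans_lt hz.2⟩) (fun t ht => ?_)
        (hsub y (Ioo_subset_Icc_self hy) z (Ioo_subset_Icc_self hz))
      exact hd t ⟨⟨hy.1.trans ht.1.1, ht.1.2.trans hz.2⟩, ht.2⟩
    rcases le_total m x with h | h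
    · simp only [key m ⟨ham, hmb⟩ x hx h]; ring
    · simp only [intervalIntegral.integral_symm x m, key x hx m ⟨ham, hmb⟩ h]; ring

/-- If `T p ≠ 0`, then `1 / T` is bounded near `p`, so `g' / g² = w g' / T` is integrable there. Its
primitive `-1 / g` then has a finite limit at `p`, which contradicts `g p = 0`. -/
theorem boundary_eq_zero {g T w : ℝ → ℂ} {a b p : ℝ} (hab : a < b) (hp : p ∈ Icc a b) {s : Set ℝ}
    (hs : s.Countable) (hT : ContinuousOn T (Icc a b)) (hg : ContinuousOn g (Icc a b))
    (hg0 : ∀ x ∈ Ioo a b, g x ≠ 0) (hgp : g p = 0)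
    (hd : ∀ x ∈ Ioo a b \ s, DifferentiableAt ℝ g x)
    (hw : IntervalIntegrable (fun x => w x * deriv g x) volume a b)
    (hTw : ∀ x ∈ Ioo a b, T x = g x ^ 2 * w x) : T p = 0 := by
  by_contra hne
  have hev : ∀ᶠ x in 𝓝[Icc a b] p, T x ≠ 0 := (hT p hp).eventually_ne hne
  obtain ⟨ε, hε, hball⟩ := Metric.mem_nhdsWithin_iff.1 hev
  set a' := max a (p - ε / 2) with ha'
  set b' := min b (p + ε / 2) with hb'
  have hab' : a' < b' := by
    rw [ha', hb', max_lt_iff, lt_min_iff, lt_min_iff]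
    refine ⟨⟨hab, ?_⟩, ?_, ?_⟩ <;> linarith [hp.1, hp.2]
  have hpI : p ∈ Icc a' b' :=
    ⟨max_le hp.1 (by linarith), le_min hp.2 (by linarith)⟩
  have hsub : Icc a' b' ⊆ Icc a b := Icc_subset_Icc (le_max_left _ _) (min_le_left _ _)
  have hsub' : Ioo a' b' ⊆ Ioo a b := Ioo_subset_Ioo (le_max_left _ _) (min_le_left _ _)
  have hT0 : ∀ x ∈ Icc a' b', T x ≠ 0 := by
    intro x hx
    refine hball ⟨?_, hsub hx⟩
    have h1 : p - ε / 2 ≤ x := (le_max_right _ _).trans hx.1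
    have h2 : x ≤ p + ε / 2 := hx.2.trans (min_le_right _ _)
    rw [Metric.mem_ball, Real.dist_eq, abs_lt]
    constructor <;> linarith
  have hint : IntervalIntegrable (fun x => -deriv g x / g x ^ 2) volume a' b' := by
    have h1 : IntervalIntegrable (fun x => w x * deriv g x) volume a' b' :=
      hw.mono_set (by rw [uIcc_of_le hab.le, uIcc_of_le hab'.le]; exact hsub)
    have h2 := h1.continuousOn_mul (g := fun x => -(T x)⁻¹)
      (by rw [uIcc_of_le hab'.le]; exact ((hT.mono hsub).inv₀ hT0).neg)
    rw [intervalIntegrable_iff_integrableOn_Ioo_of_le hab'.le] at h2 ⊢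
    refine h2.congr_fun (fun x hx => ?_) measurableSet_Ioo
    have hTx := hT0 x (Ioo_subset_Icc_self hx)
    have hgx := hg0 x (hsub' hx)
    have hwx : w x ≠ 0 := by
      intro h0; exact hTx (by rw [hTw x (hsub' hx), h0, mul_zero])
    simp only [hTw x (hsub' hx)]
    field_simp
  obtain ⟨H, hH, hHeq⟩ := exists_continuousOn_extension (f := fun x => (g x)⁻¹) hab' hs
    ((hg.mono (hsub'.trans Ioo_subset_Icc_self)).inv₀ fun x hx => hg0 x (hsub' hx))
    (fun x hx => (hd x ⟨hsub' hx.1, hx.2⟩).hasDerivAt.fun_inv (hg0 x (hsub' hx.1))) hint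
  -- The identity `H g = 1` passes by density to the closed interval, hence to `p`.
  have hprod : EqOn (fun x => H x * g x) (fun _ => 1) (Icc a' b') := by
    rw [← closure_Ioo hab'.ne]
    refine EqOn.of_subset_closure (s := Ioo a' b') (t := closure (Ioo a' b')) (fun x hx => ?_)
      ?_ continuousOn_const subset_closure subset_rfl
    · simp only [hHeq hx, inv_mul_cancel₀ (hg0 x (hsub' hx))]
    · rw [closure_Ioo hab'.ne]
      exact hH.mul (hg.mono hsub)
  have := hprod hpI
  simp [hgp] at this

/-! ### Basic properties of a loop -/

theorem exists_mem_Ioo_of_notMem_range {a : ℕ → ℝ} {k : ℕ} {x : ℝ} (h0 : a 0 ≤ x) (hk : x < a k)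
    (hx : ∀ i, x ≠ a i) : ∃ i < k, x ∈ Ioo (a i) (a (i + 1)) := by
  induction k with
  | zero => exact absurd hk (not_lt.2 h0)
  | succ k ih =>
    rcases lt_or_ge x (a k) with h | h
    · obtain ⟨i, hi, hxi⟩ := ih h
      exact ⟨i, hi.trans (Nat.lt_succ_self k), hxi⟩
    · exact ⟨k, Nat.lt_succ_self k, lt_of_le_of_ne h (hx k).symm, hk⟩

theorem continuousOn_of_pieces {f : ℝ → ℂ} {a : ℕ → ℝ} (ha : Monotone a) (k : ℕ)
    (h : ∀ i < k, ContinuousOn f (Icc (a i) (a (i + 1)))) : ContinuousOn f (Icc (a 0) (a k)) := by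
  induction k with
  | zero => simp
  | succ k ih =>
    rw [← Icc_union_Icc_eq_Icc (ha (Nat.zero_le k)) (ha (Nat.le_succ k))]
    exact (ih fun i hi => h i (hi.trans (Nat.lt_succ_self k))).union_of_isClosed
      (h k (Nat.lt_succ_self k)) isClosed_Icc isClosed_Icc

namespace OriginLoop

variable (γ : OriginLoop)

theorem continuousOn : ContinuousOn γ.toFun (Icc 0 1) := by
  obtain ⟨k, a, ha, h0, h1, h⟩ := γ.piecewise_C1
  have := continuousOn_of_pieces ha k fun i hi => (h i hi).continuousOn
  rwa [h0, h1] at this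

theorem exists_countable_differentiableAt :
    ∃ s : Set ℝ, s.Countable ∧ ∀ x ∈ Ioo (0 : ℝ) 1 \ s, DifferentiableAt ℝ γ.toFun x := by
  obtain ⟨k, a, ha, h0, h1, h⟩ := γ.piecewise_C1
  refine ⟨range a, countable_range a, fun x hx => ?_⟩
  obtain ⟨i, hi, hxi⟩ := exists_mem_Ioo_of_notMem_range (k := k) (by rw [h0]; exact hx.1.1.le)
    (by rw [h1]; exact hx.1.2) (fun i hxi => hx.2 ⟨i, hxi.symm⟩)
  exact ((h i hi).differentiableOn one_ne_zero).differentiableAt (Icc_mem_nhds hxi.1 hxi.2)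

theorem isCompact_trace : IsCompact γ.trace := isCompact_Icc.image_of_continuousOn γ.continuousOn

theorem isClosed_trace : IsClosed γ.trace := γ.isCompact_trace.isClosed

theorem mem_trace {t : ℝ} (ht : t ∈ Icc (0 : ℝ) 1) : γ.toFun t ∈ γ.trace := mem_image_of_mem _ ht

theorem zero_mem_trace : (0 : ℂ) ∈ γ.trace := ⟨0, by simp, γ.map_zero⟩

theorem ne_zero {t : ℝ} (ht : t ∈ Ioo (0 : ℝ) 1) : γ.toFun t ≠ 0 := fun h =>
  ht.1.ne' (γ.injOn ⟨ht.1.le, ht.2⟩ ⟨le_rfl, one_pos⟩ (h.trans γ.map_zero.symm))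

theorem mem_trace_diff {t : ℝ} (ht : t ∈ Ioo (0 : ℝ) 1) : γ.toFun t ∈ γ.trace \ {0} :=
  ⟨γ.mem_trace (Ioo_subset_Icc_self ht), γ.ne_zero ht⟩

theorem comp_continuousOn {g : ℂ → ℂ} (hg : ContinuousOn g γ.trace) :
    ContinuousOn (fun t => g (γ.toFun t)) (Icc 0 1) :=
  hg.comp γ.continuousOn fun _ ht => γ.mem_trace ht

theorem intervalIntegrable_mul {g : ℂ → ℂ} (hg : ContinuousOn g γ.trace) {f : ℝ → ℂ}
    (hf : IntervalIntegrable f volume 0 1) :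
    IntervalIntegrable (fun t => g (γ.toFun t) * f t) volume 0 1 :=
  hf.continuousOn_mul (by rw [uIcc_of_le zero_le_one]; exact γ.comp_continuousOn hg)

/-- Integration by parts along a loop against a weight `w` which agrees with a holomorphic function
`u` off the base point, when `z ^ 2 * u'` is integrable: there is no boundary term. -/
theorem integral_by_parts {w u v R R' : ℂ → ℂ} {u' : ℂ → ℂ}
    (hwu : ∀ z ∈ γ.trace \ {0}, w z = u z) (hu : ∀ z ∈ γ.trace \ {0}, HasDerivAt u (u' z) z)
    (huv : ∀ z ∈ γ.trace \ {0}, z ^ 2 * u' z = v z)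
    (hw : IntervalIntegrable (fun t => w (γ.toFun t) * deriv γ.toFun t) volume 0 1)
    (hv : IntervalIntegrable (fun t => v (γ.toFun t) * deriv γ.toFun t) volume 0 1)
    (hR : ∀ z ∈ γ.trace, HasDerivAt R (R' z) z) (hR' : ContinuousOn R' γ.trace) :
    IntervalIntegrable (fun t => (R' (γ.toFun t) * (γ.toFun t ^ 2 * w (γ.toFun t)) +
      R (γ.toFun t) * (2 * γ.toFun t * w (γ.toFun t) + v (γ.toFun t))) * deriv γ.toFun t)
      volume 0 1 ∧
    ∫ t in (0 : ℝ)..1, (R' (γ.toFun t) * (γ.toFun t ^ 2 * w (γ.toFun t)) +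
      R (γ.toFun t) * (2 * γ.toFun t * w (γ.toFun t) + v (γ.toFun t))) * deriv γ.toFun t = 0 := by
  obtain ⟨s, hs, hsd⟩ := γ.exists_countable_differentiableAt
  have hRc : ContinuousOn R γ.trace := fun z hz => (hR z hz).continuousAt.continuousWithinAt
  set T : ℝ → ℂ := fun t => γ.toFun t ^ 2 * w (γ.toFun t) with hTdef
  have hTeq : EqOn T (fun t => γ.toFun t ^ 2 * u (γ.toFun t)) (Ioo 0 1) := fun t ht => by
    simp only [hTdef, hwu _ (γ.mem_trace_diff ht)]
  have hTd : ∀ t ∈ Ioo (0 : ℝ) 1 \ s, HasDerivAt T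
      ((2 * γ.toFun t * w (γ.toFun t) + v (γ.toFun t)) * deriv γ.toFun t) t := by
    intro t ht
    have hz := γ.mem_trace_diff ht.1
    have h1 : HasDerivAt (fun z => z ^ 2 * u z)
        (2 * γ.toFun t * w (γ.toFun t) + v (γ.toFun t)) (γ.toFun t) := by
      refine ((hasDerivAt_pow 2 (γ.toFun t)).fun_mul (hu _ hz)).congr_deriv ?_
      rw [huv _ hz, hwu _ hz]; simp
    have h2 := h1.comp_of_eq t (hsd t ht).hasDerivAt rfl
    refine h2.congr_of_eventuallyEq ?_
    filter_upwards [Ioo_mem_nhds ht.1.1 ht.1.2] with x hx using hTeq hx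
  have hTi : IntervalIntegrable (fun t => (2 * γ.toFun t * w (γ.toFun t) + v (γ.toFun t)) *
      deriv γ.toFun t) volume 0 1 := by
    have h1 := (γ.intervalIntegrable_mul (g := fun z => 2 * z) (by fun_prop) hw).add hv
    refine h1.congr fun t _ => ?_
    ring
  -- Only the open interval is available at first: `u` is controlled away from the base point.
  have hTcI : ContinuousOn T (Ioo 0 1) := by
    refine ContinuousOn.congr ?_ hTeq
    have hγ : ContinuousOn γ.toFun (Ioo 0 1) := γ.continuousOn.mono Ioo_subset_Icc_self
    refine (hγ.pow 2).mul ?_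
    intro t ht
    exact (hu _ (γ.mem_trace_diff ht)).continuousAt.comp_continuousWithinAt (hγ t ht)
  obtain ⟨F, hF, hFT⟩ := exists_continuousOn_extension one_pos hs hTcI hTd hTi
  have hF0 : ∀ p ∈ Icc (0 : ℝ) 1, γ.toFun p = 0 → F p = 0 := fun p hp h0 =>
    boundary_eq_zero one_pos hp hs hF γ.continuousOn (fun _ => γ.ne_zero) h0 hsd hw fun x hx => hFT hx
  -- At the endpoints `T` is `0` whatever the value of `w` at the base point, because of the factor
  -- `z ^ 2`; so `T` is its own continuous extension.
  have hFT' : EqOn T F (Icc 0 1) := by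
    intro t ht
    rcases eq_or_lt_of_le ht.1 with h | h
    · rw [← h, hF0 0 (by simp) γ.map_zero]; simp [hTdef, γ.map_zero]
    rcases eq_or_lt_of_le ht.2 with h' | h'
    · rw [h', hF0 1 (by simp) γ.map_one]; simp [hTdef, γ.map_one]
    · exact (hFT ⟨h, h'⟩).symm
  have hTc : ContinuousOn T (Icc 0 1) := hF.congr hFT'
  have hint : IntervalIntegrable (fun t => (R' (γ.toFun t) * (γ.toFun t ^ 2 * w (γ.toFun t)) +
      R (γ.toFun t) * (2 * γ.toFun t * w (γ.toFun t) + v (γ.toFun t))) * deriv γ.toFun t)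
      volume 0 1 := by
    have h1 := (γ.intervalIntegrable_mul (g := fun z => R' z * z ^ 2) (by fun_prop) hw).add
      (γ.intervalIntegrable_mul hRc hTi)
    refine h1.congr fun t _ => ?_
    ring
  refine ⟨hint, ?_⟩
  have := integral_eq_of_hasDerivAt_off_countable_of_le (fun t => R (γ.toFun t) * T t) _
    zero_le_one hs ((γ.comp_continuousOn hRc).mul hTc) (fun t ht => ?_) hint
  · rw [this]; simp [hTdef, γ.map_zero, γ.map_one]
  · have h1 := (hR _ (γ.mem_trace (Ioo_subset_Icc_self ht.1))).comp_of_eq t (hsd t ht).hasDerivAt rfl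
    refine (h1.fun_mul (hTd t ht)).congr_deriv ?_
    simp only [hTdef, Function.comp]; ring

end OriginLoop

/-! ### Holomorphic dependence on a parameter -/

/-- Differentiation under the integral by domination: Cauchy's estimate on discs of radius `r / 3`
turns the bound `B` on the kernel into a bound on its derivative over the ball of radius `r / 2`. -/
theorem hasDerivAt_integral_mul {f : ℝ → ℂ} (hf : IntervalIntegrable f volume 0 1)
    {K : ℝ → ℂ → ℂ} {z₀ : ℂ} {r B : ℝ} (hr : 0 < r)
    (hK : ∀ t ∈ Icc (0 : ℝ) 1, DifferentiableOn ℂ (K t) (Metric.ball z₀ r))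
    (hB : ∀ t ∈ Icc (0 : ℝ) 1, ∀ z ∈ Metric.ball z₀ r, ‖K t z‖ ≤ B)
    (hc : ∀ z ∈ Metric.ball z₀ r, ContinuousOn (fun t => K t z) (Icc 0 1)) :
    HasDerivAt (fun z => ∫ t in (0 : ℝ)..1, K t z * f t)
      (∫ t in (0 : ℝ)..1, deriv (K t) z₀ * f t) z₀ := by
  have hI : uIoc (0 : ℝ) 1 ⊆ Icc 0 1 := by
    rw [uIoc_of_le zero_le_one]; exact Ioc_subset_Icc_self
  have hint : ∀ z ∈ Metric.ball z₀ r, IntervalIntegrable (fun t => K t z * f t) volume 0 1 :=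
    fun z hz => hf.continuousOn_mul (by rw [uIcc_of_le zero_le_one]; exact hc z hz)
  have hd : ∀ t ∈ Icc (0 : ℝ) 1, ∀ z ∈ Metric.ball z₀ r, HasDerivAt (K t) (deriv (K t) z) z :=
    fun t ht z hz => ((hK t ht).differentiableAt (Metric.isOpen_ball.mem_nhds hz)).hasDerivAt
  have hz₀ : z₀ ∈ Metric.ball z₀ r := Metric.mem_ball_self hr
  refine (intervalIntegral.hasDerivAt_integral_of_dominated_loc_of_deriv_le
    (F' := fun z t => deriv (K t) z * f t) (s := Metric.ball z₀ (r / 2))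
    (bound := fun t => B / (r / 3) * ‖f t‖) (Metric.ball_mem_nhds _ (half_pos hr)) ?_
    (hint z₀ hz₀) ?_ ?_ ?_ ?_).2
  · filter_upwards [Metric.ball_mem_nhds z₀ hr] with z hz using (hint z hz).aestronglyMeasurable_restrict_uIoc
  -- Measurability in `t` of the derivative: it is a pointwise limit of difference quotients. The
  -- shift by `2` keeps every step strictly smaller than `r`.
  · set h : ℕ → ℂ := fun n => ((r / (n + 2) : ℝ) : ℂ) with hh
    have hpos : ∀ n : ℕ, 0 < r / ((n : ℝ) + 2) := fun n => by positivity
    have hh0 : ∀ n, h n ≠ 0 := fun n => by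
      exact Complex.ofReal_ne_zero.2 (hpos n).ne'
    have hhball : ∀ n, z₀ + h n ∈ Metric.ball z₀ r := fun n => by
      rw [mem_ball_iff_norm, add_sub_cancel_left, hh, Complex.norm_real, Real.norm_eq_abs,
        abs_of_pos (hpos n), div_lt_iff₀ (by positivity)]
      nlinarith [(Nat.cast_nonneg n : (0 : ℝ) ≤ n)]
    have hlim : Tendsto h atTop (𝓝[≠] 0) := by
      refine tendsto_nhdsWithin_iff.2 ⟨?_, Eventually.of_forall hh0⟩
      have h1 : Tendsto (fun n : ℕ => r / ((n : ℝ) + 2)) atTop (𝓝 0) :=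
        tendsto_const_nhds.div_atTop
          (tendsto_atTop_add_const_right _ _ tendsto_natCast_atTop_atTop)
      exact (Complex.continuous_ofReal.tendsto' 0 0 Complex.ofReal_zero).comp h1
    refine aestronglyMeasurable_of_tendsto_ae atTop
      (f := fun n t => (h n)⁻¹ • (K t (z₀ + h n) * f t - K t z₀ * f t)) (fun n => ?_) ?_
    · exact ((hint _ (hhball n)).sub (hint _ hz₀)).aestronglyMeasurable_restrict_uIoc.const_smul (h n)⁻¹
    · refine (ae_restrict_iff' measurableSet_uIoc).2 (Eventually.of_forall fun t ht => ?_)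
      have := ((hasDerivAt_iff_tendsto_slope_zero.1 (hd t (hI ht) z₀ hz₀)).comp hlim).mul_const (f t)
      refine this.congr fun n => ?_
      simp only [Function.comp, smul_eq_mul]; ring
  · refine Eventually.of_forall fun t ht z hz => ?_
    rw [norm_mul]
    refine mul_le_mul_of_nonneg_right ?_ (norm_nonneg _)
    have hsub : Metric.closedBall z (r / 3) ⊆ Metric.ball z₀ r := by
      refine Metric.closedBall_subset_ball' ?_
      rw [Metric.mem_ball] at hz
      linarith
    refine Complex.norm_deriv_le_of_forall_mem_sphere_norm_le (by positivity) ?_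
      fun w hw => hB t (hI ht) w (hsub (Metric.sphere_subset_closedBall hw))
    refine DifferentiableOn.diffContOnCl ((hK t (hI ht)).mono ?_)
    rwa [closure_ball _ (by positivity)]
  · exact hf.norm.const_mul _
  · refine Eventually.of_forall fun t ht z hz => ?_
    exact (hd t (hI ht) z (Metric.ball_subset_ball (by linarith) hz)).mul_const _

theorem differentiable_dslope {g : ℂ → ℂ} (hg : Differentiable ℂ g) (a : ℂ) :
    Differentiable ℂ (dslope g a) := by
  rw [← differentiableOn_univ, Complex.differentiableOn_dslope univ_mem]
  exact hg.differentiableOn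

theorem dslope_symm (g : ℂ → ℂ) (a b : ℂ) : dslope g a b = dslope g b a := by
  rcases eq_or_ne a b with rfl | h
  · rfl
  · rw [dslope_of_ne _ h.symm, dslope_of_ne _ h, slope_comm]

/-- The mean value inequality on the convex ball bounds divided differences by the maximum of the
derivative, uniformly up to the diagonal. -/
theorem exists_norm_dslope_le {g : ℂ → ℂ} (hg : Differentiable ℂ g) (R : ℝ) :
    ∃ B, ∀ a ∈ Metric.closedBall (0 : ℂ) R, ∀ b ∈ Metric.closedBall (0 : ℂ) R,
      ‖dslope g a b‖ ≤ B := by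
  have hc : Continuous (deriv g) := (hg.contDiff (n := 1)).continuous_deriv le_rfl
  obtain ⟨B, hB⟩ := (isCompact_closedBall (0 : ℂ) R).exists_bound_of_continuousOn hc.continuousOn
  refine ⟨B, fun a ha b hb => ?_⟩
  rcases eq_or_ne b a with rfl | h
  · rw [dslope_same]; exact hB b hb
  · rw [dslope_of_ne _ h, slope_def_field, norm_div, div_le_iff₀ (norm_pos_iff.2 (sub_ne_zero.2 h))]
    exact (convex_closedBall (0 : ℂ) R).norm_image_sub_le_of_norm_deriv_le
      (fun x _ => hg x) hB ha hb

/-- The source of every entire function in the proof: a divided difference has no singularity at `t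
= z`, so the integral is holomorphic even at points of the loop. -/
theorem differentiable_integral_dslope (γ : OriginLoop) {g : ℂ → ℂ} (hg : Differentiable ℂ g)
    {f : ℝ → ℂ} (hf : IntervalIntegrable f volume 0 1) :
    Differentiable ℂ fun z => ∫ t in (0 : ℝ)..1, dslope g z (γ.toFun t) * f t := by
  intro z₀
  obtain ⟨R, hR⟩ := γ.isCompact_trace.isBounded.subset_closedBall (0 : ℂ)
  obtain ⟨B, hB⟩ := exists_norm_dslope_le hg (max R (‖z₀‖ + 1))
  refine (hasDerivAt_integral_mul hf (K := fun t z => dslope g z (γ.toFun t)) (B := B) one_pos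
    (fun t _ => ?_) (fun t ht z hz => ?_) fun z _ => ?_).differentiableAt
  -- Symmetry moves `z` to the second argument, in which the divided difference is known to be
  -- entire.
  · simp only [fun z => dslope_symm g z (γ.toFun t)]
    exact (differentiable_dslope hg _).differentiableOn
  · refine hB _ (Metric.closedBall_subset_closedBall (le_max_right _ _) ?_) _
      (Metric.closedBall_subset_closedBall (le_max_left _ _) (hR (γ.mem_trace ht)))
    rw [mem_ball_iff_norm] at hz
    rw [mem_closedBall_zero_iff]
    have := norm_add_le (z - z₀) z₀
    rw [sub_add_cancel] at this
    linarith
  · exact γ.comp_continuousOn (differentiable_dslope hg z).continuous.continuousOn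

theorem hasDerivAt_integral_cauchy (γ : OriginLoop) {f : ℝ → ℂ}
    (hf : IntervalIntegrable f volume 0 1) {z₀ : ℂ} (hz₀ : z₀ ∉ γ.trace) :
    HasDerivAt (fun z => ∫ t in (0 : ℝ)..1, (γ.toFun t - z)⁻¹ * f t)
      (∫ t in (0 : ℝ)..1, ((γ.toFun t - z₀) ^ 2)⁻¹ * f t) z₀ := by
  obtain ⟨r, hr, hball⟩ := Metric.isOpen_iff.1 γ.isClosed_trace.isOpen_compl z₀ hz₀
  have hdist : ∀ t ∈ Icc (0 : ℝ) 1, ∀ z ∈ Metric.ball z₀ (r / 2), r / 2 ≤ ‖γ.toFun t - z‖ := by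
    intro t ht z hz
    by_contra! hlt
    refine hball (a := γ.toFun t) ?_ (γ.mem_trace ht)
    rw [mem_ball_iff_norm] at hz ⊢
    have := norm_add_le (γ.toFun t - z) (z - z₀)
    rw [sub_add_sub_cancel] at this
    linarith
  have hne : ∀ t ∈ Icc (0 : ℝ) 1, ∀ z ∈ Metric.ball z₀ (r / 2), γ.toFun t - z ≠ 0 :=
    fun t ht z hz => norm_pos_iff.1 ((half_pos hr).trans_le (hdist t ht z hz))
  have hd : ∀ t ∈ Icc (0 : ℝ) 1, ∀ z ∈ Metric.ball z₀ (r / 2),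
      HasDerivAt (fun z => (γ.toFun t - z)⁻¹) (((γ.toFun t - z) ^ 2)⁻¹) z := by
    intro t ht z hz
    refine (((hasDerivAt_id' z).const_sub (γ.toFun t)).fun_inv (hne t ht z hz)).congr_deriv ?_
    rw [neg_neg, one_div]
  have := hasDerivAt_integral_mul hf (K := fun t z => (γ.toFun t - z)⁻¹) (z₀ := z₀)
    (B := (r / 2)⁻¹) (half_pos hr) (fun t ht z hz => (hd t ht z hz).differentiableAt.differentiableWithinAt)
    (fun t ht z hz => ?_) fun z hz => ?_
  · refine this.congr_deriv (intervalIntegral.integral_congr fun t ht => ?_)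
    rw [uIcc_of_le zero_le_one] at ht
    simp only [(hd t ht z₀ (Metric.mem_ball_self (half_pos hr))).deriv]
  · rw [norm_inv]
    exact inv_anti₀ (half_pos hr) (hdist t ht z hz)
  · exact (γ.continuousOn.sub continuousOn_const).inv₀ fun t ht => hne t ht z hz

/-! ### Entrywise calculus of matrix functions -/

/-- Entrywise complex derivative of a matrix function at a point. -/
def HasMatDerivAt {ι : Type} (F : ℂ → Matrix ι ι ℂ) (F' : Matrix ι ι ℂ) (z : ℂ) : Prop :=
  ∀ i j, HasDerivAt (fun w => F w i j) (F' i j) z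

section Calculus

variable {ι : Type} {F G : ℂ → Matrix ι ι ℂ} {F' G' : Matrix ι ι ℂ} {z : ℂ}

theorem HasMatDerivAt.matDeriv (h : HasMatDerivAt F F' z) : matDeriv F z = F' := by
  ext i j; exact (h i j).deriv

theorem HasMatDerivAt.matDifferentiableAt (h : HasMatDerivAt F F' z) : MatDifferentiableAt F z :=
  fun i j => (h i j).differentiableAt

theorem MatDifferentiableAt.hasMatDerivAt (h : MatDifferentiableAt F z) :
    HasMatDerivAt F (matDeriv F z) z := fun i j => (h i j).hasDerivAt

theorem HasMatDerivAt.unique (h : HasMatDerivAt F F' z) (h' : HasMatDerivAt F G' z) : F' = G' :=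
  h.matDeriv.symm.trans h'.matDeriv

theorem hasMatDerivAt_const (A : Matrix ι ι ℂ) (z : ℂ) : HasMatDerivAt (fun _ => A) 0 z :=
  fun i j => hasDerivAt_const z (A i j)

theorem HasMatDerivAt.congr (h : HasMatDerivAt F F' z) (hFG : G =ᶠ[𝓝 z] F) :
    HasMatDerivAt G F' z := fun i j =>
  (h i j).congr_of_eventuallyEq (hFG.mono fun w hw => by simp only [hw])

theorem HasMatDerivAt.add (hF : HasMatDerivAt F F' z) (hG : HasMatDerivAt G G' z) :
    HasMatDerivAt (fun w => F w + G w) (F' + G') z := fun i j => (hF i j).fun_add (hG i j)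

theorem HasMatDerivAt.neg (hF : HasMatDerivAt F F' z) :
    HasMatDerivAt (fun w => -F w) (-F') z := fun i j => (hF i j).fun_neg

theorem HasMatDerivAt.smul {c : ℂ → ℂ} {c' : ℂ} (hc : HasDerivAt c c' z)
    (hF : HasMatDerivAt F F' z) :
    HasMatDerivAt (fun w => c w • F w) (c' • F z + c z • F') z := fun i j =>
  hc.fun_mul (hF i j)

theorem HasMatDerivAt.mul [Fintype ι] (hF : HasMatDerivAt F F' z) (hG : HasMatDerivAt G G' z) :
    HasMatDerivAt (fun w => F w * G w) (F' * G z + F z * G') z := fun i j => by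
  simp only [Matrix.mul_apply, Matrix.add_apply, ← Finset.sum_add_distrib]
  exact HasDerivAt.fun_sum fun k _ => (hF i k).fun_mul (hG k j)

theorem hasMatDerivAt_fromBlocks {A B C D : ℂ → Matrix ι ι ℂ} {A' B' C' D' : Matrix ι ι ℂ}
    (hA : HasMatDerivAt A A' z) (hB : HasMatDerivAt B B' z) (hC : HasMatDerivAt C C' z)
    (hD : HasMatDerivAt D D' z) :
    HasMatDerivAt (fun w => Matrix.fromBlocks (A w) (B w) (C w) (D w))
      (Matrix.fromBlocks A' B' C' D') z := by
  rintro (i | i) (j | j)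
  · exact hA i j
  · exact hB i j
  · exact hC i j
  · exact hD i j

theorem MatDifferentiableAt.det [Fintype ι] [DecidableEq ι] (h : MatDifferentiableAt F z) :
    DifferentiableAt ℂ (fun w => (F w).det) z := by
  simp only [Matrix.det_apply]
  exact DifferentiableAt.fun_sum fun σ _ =>
    (DifferentiableAt.fun_finsetProd fun i _ => h (σ i) i).const_smul _

/-- By Cramer's rule the entries of the inverse are quotients of determinants in the entries of `F`.
-/
theorem MatDifferentiableAt.inv [Fintype ι] [DecidableEq ι] (h : MatDifferentiableAt F z)
    (hu : IsUnit (F z)) : MatDifferentiableAt (fun w => (F w)⁻¹) z := by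
  intro i j
  have hdet : (F z).det ≠ 0 := ((Matrix.isUnit_iff_isUnit_det _).1 hu).ne_zero
  simp only [Matrix.inv_def, Ring.inverse_eq_inv, Matrix.smul_apply, smul_eq_mul,
    Matrix.adjugate_apply]
  refine (h.det.fun_inv hdet).fun_mul (MatDifferentiableAt.det fun k l => ?_)
  simp only [Matrix.updateRow_apply]
  split_ifs
  · exact differentiableAt_const _
  · exact h k l

/-- The formula follows by differentiating `F F⁻¹ = 1`, which holds near `z` since the determinant
stays nonzero. -/
theorem HasMatDerivAt.inv [Fintype ι] [DecidableEq ι] (h : HasMatDerivAt F F' z)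
    (hu : IsUnit (F z)) : HasMatDerivAt (fun w => (F w)⁻¹) (-((F z)⁻¹ * F' * (F z)⁻¹)) z := by
  have hd := (MatDifferentiableAt.inv h.matDifferentiableAt hu).hasMatDerivAt
  have hdet : (F z).det ≠ 0 := ((Matrix.isUnit_iff_isUnit_det _).1 hu).ne_zero
  have hev : (fun w => F w * (F w)⁻¹) =ᶠ[𝓝 z] fun _ => (1 : Matrix ι ι ℂ) :=
    (h.matDifferentiableAt.det.continuousAt.eventually_ne hdet).mono fun w hw =>
      Matrix.mul_nonsing_inv _ hw.isUnit
  have h0 := (h.mul hd).unique ((hasMatDerivAt_const 1 z).congr hev)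
  have h1 : BesselMBP.matDeriv (fun w => (F w)⁻¹) z = -((F z)⁻¹ * F' * (F z)⁻¹) := by
    have h2 := congrArg ((F z)⁻¹ * ·) h0
    simp only [mul_add, mul_zero] at h2
    rw [← mul_assoc, ← mul_assoc, Matrix.nonsing_inv_mul _ hdet.isUnit, one_mul] at h2
    rw [eq_neg_iff_add_eq_zero, add_comm]
    exact h2
  rwa [h1] at hd

end Calculus

section MatEntire

variable {ι : Type} {F G : ℂ → Matrix ι ι ℂ}

theorem MatEntire.matDifferentiableAt (h : MatEntire F) (z : ℂ) : MatDifferentiableAt F z :=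
  fun i j => h i j z

theorem MatEntire.continuous (h : MatEntire F) : Continuous F :=
  continuous_pi fun i => continuous_pi fun j => (h i j).continuous

theorem matEntire_const (A : Matrix ι ι ℂ) : MatEntire fun _ => A :=
  fun i j => differentiable_const (A i j)

theorem MatEntire.add (hF : MatEntire F) (hG : MatEntire G) : MatEntire fun z => F z + G z :=
  fun i j => (hF i j).fun_add (hG i j)

theorem MatEntire.sub (hF : MatEntire F) (hG : MatEntire G) : MatEntire fun z => F z - G z :=
  fun i j => (hF i j).fun_sub (hG i j)

theorem MatEntire.mul [Fintype ι] (hF : MatEntire F) (hG : MatEntire G) :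
    MatEntire fun z => F z * G z := fun i j z =>
  (((hF.matDifferentiableAt z).hasMatDerivAt.mul (hG.matDifferentiableAt z).hasMatDerivAt) i
    j).differentiableAt

theorem MatEntire.smul {c : ℂ → ℂ} (hc : Differentiable ℂ c) (hF : MatEntire F) :
    MatEntire fun z => c z • F z := fun i j => hc.fun_mul (hF i j)

theorem MatEntire.matDeriv (hF : MatEntire F) : MatEntire (matDeriv F) := fun i j => by
  simpa [BesselMBP.matDeriv] using (hF i j).contDiff.differentiable_deriv_two

theorem matEntire_sum {α : Type*} (s : Finset α) {H : α → ℂ → Matrix ι ι ℂ}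
    (h : ∀ a ∈ s, MatEntire (H a)) : MatEntire fun z => ∑ a ∈ s, H a z := fun i j => by
  simp only [Matrix.sum_apply]
  exact Differentiable.fun_sum fun a ha => h a ha i j

theorem matEntire_fromBlocks {A B C D : ℂ → Matrix ι ι ℂ} (hA : MatEntire A) (hB : MatEntire B)
    (hC : MatEntire C) (hD : MatEntire D) :
    MatEntire fun z => Matrix.fromBlocks (A z) (B z) (C z) (D z) := by
  rintro (i | i) (j | j)
  · exact hA i j
  · exact hB i j
  · exact hC i j
  · exact hD i j

end MatEntire

/-! ### Linearity of the loop integral -/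

/-- Entrywise integrability of a matrix function along a loop. -/
def LoopIntegrable {N : ℕ} (γ : OriginLoop) (F : ℂ → Mat N) : Prop :=
  ∀ i j, IntervalIntegrable (fun t : ℝ => F (γ.toFun t) i j * deriv γ.toFun t) volume 0 1

section LoopIntegral

variable {N : ℕ} {γ : OriginLoop} {F G : ℂ → Mat N}

theorem loopIntegral_congr (h : ∀ z ∈ γ.trace, F z = G z) :
    loopIntegral γ F = loopIntegral γ G := by
  ext i j
  simp only [loopIntegral, Matrix.of_apply]
  congr 1
  refine intervalIntegral.integral_congr fun t ht => ?_
  rw [uIcc_of_le zero_le_one] at ht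
  simp only [h _ (γ.mem_trace ht)]

theorem LoopIntegrable.add (hF : LoopIntegrable γ F) (hG : LoopIntegrable γ G) :
    LoopIntegrable γ fun t => F t + G t := fun i j => by
  simpa only [Matrix.add_apply, add_mul] using (hF i j).add (hG i j)

theorem LoopIntegrable.smul {c : ℂ → ℂ} (hc : ContinuousOn c γ.trace) (hF : LoopIntegrable γ F) :
    LoopIntegrable γ fun t => c t • F t := fun i j => by
  simpa only [Matrix.smul_apply, smul_eq_mul, mul_assoc] using γ.intervalIntegrable_mul hc (hF i j)

theorem continuousOn_matrix_entry {ι : Type*} {s : Set ℂ} {F : ℂ → Matrix ι ι ℂ}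
    (h : ContinuousOn F s) (i j : ι) : ContinuousOn (fun z => F z i j) s :=
  (continuous_apply_apply i j).comp_continuousOn h

theorem LoopIntegrable.mul_left (hG : ContinuousOn G γ.trace) (hF : LoopIntegrable γ F) :
    LoopIntegrable γ fun t => G t * F t := fun i j => by
  simp only [Matrix.mul_apply, Finset.sum_mul, mul_assoc]
  have := IntervalIntegrable.sum Finset.univ fun k _ =>
    γ.intervalIntegrable_mul (continuousOn_matrix_entry hG i k) (hF k j)
  refine this.congr_uIoo fun t _ => ?_
  simp only [Finset.sum_apply]

theorem LoopIntegrable.mul_right (hF : LoopIntegrable γ F) (hG : ContinuousOn G γ.trace) :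
    LoopIntegrable γ fun t => F t * G t := fun i j => by
  have := IntervalIntegrable.sum Finset.univ fun k _ =>
    γ.intervalIntegrable_mul (continuousOn_matrix_entry hG k j) (hF i k)
  refine this.congr_uIoo fun t _ => ?_
  simp only [Finset.sum_apply, Matrix.mul_apply, Finset.sum_mul]
  exact Finset.sum_congr rfl fun k _ => by ring

theorem LoopIntegrable.sum {α : Type*} (s : Finset α) {H : α → ℂ → Mat N}
    (h : ∀ a ∈ s, LoopIntegrable γ (H a)) : LoopIntegrable γ fun t => ∑ a ∈ s, H a t := fun i j => by
  refine (IntervalIntegrable.sum s fun a ha => h a ha i j).congr_uIoo fun t _ => ?_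
  simp only [Finset.sum_apply, Matrix.sum_apply, Finset.sum_mul]

theorem loopIntegral_add (hF : LoopIntegrable γ F) (hG : LoopIntegrable γ G) :
    loopIntegral γ (fun t => F t + G t) = loopIntegral γ F + loopIntegral γ G := by
  ext i j
  simp only [loopIntegral, Matrix.of_apply, Matrix.add_apply, add_mul]
  rw [intervalIntegral.integral_add (hF i j) (hG i j), mul_add]

theorem loopIntegral_sub (hF : LoopIntegrable γ F) (hG : LoopIntegrable γ G) :
    loopIntegral γ (fun t => F t - G t) = loopIntegral γ F - loopIntegral γ G := by
  ext i j
  simp only [loopIntegral, Matrix.of_apply, Matrix.sub_apply, sub_mul]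
  rw [intervalIntegral.integral_sub (hF i j) (hG i j), mul_sub]

theorem loopIntegral_zero : loopIntegral γ (fun _ => (0 : Mat N)) = 0 := by
  ext i j
  simp [loopIntegral]

theorem loopIntegral_smul (c : ℂ) (F : ℂ → Mat N) :
    loopIntegral γ (fun t => c • F t) = c • loopIntegral γ F := by
  ext i j
  simp only [loopIntegral, Matrix.of_apply, Matrix.smul_apply, smul_eq_mul, mul_assoc]
  rw [intervalIntegral.integral_const_mul]
  ring

theorem loopIntegral_const_mul (hF : LoopIntegrable γ F) (A : Mat N) :
    loopIntegral γ (fun t => A * F t) = A * loopIntegral γ F := by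
  ext i j
  simp only [loopIntegral, Matrix.of_apply, Matrix.mul_apply, Finset.sum_mul, mul_assoc]
  rw [intervalIntegral.integral_finsetSum fun k _ => (hF k j).const_mul _, Finset.mul_sum]
  refine Finset.sum_congr rfl fun k _ => ?_
  rw [intervalIntegral.integral_const_mul]
  ring

theorem loopIntegral_mul_const (hF : LoopIntegrable γ F) (A : Mat N) :
    loopIntegral γ (fun t => F t * A) = loopIntegral γ F * A := by
  ext i j
  have h : ∀ t : ℝ, (F (γ.toFun t) * A) i j * deriv γ.toFun t =
      ∑ k, F (γ.toFun t) i k * deriv γ.toFun t * A k j := fun t => by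
    rw [Matrix.mul_apply, Finset.sum_mul]
    exact Finset.sum_congr rfl fun k _ => by ring
  change (2 * (Real.pi : ℂ) * Complex.I)⁻¹ *
    (∫ t in (0 : ℝ)..1, (F (γ.toFun t) * A) i j * deriv γ.toFun t) =
    ∑ k, loopIntegral γ F i k * A k j
  simp only [h]
  rw [intervalIntegral.integral_finsetSum fun k _ => (hF i k).mul_const _, Finset.mul_sum]
  refine Finset.sum_congr rfl fun k _ => ?_
  rw [intervalIntegral.integral_mul_const]
  simp only [loopIntegral, Matrix.of_apply]
  ring

theorem loopIntegral_sum {α : Type*} (s : Finset α) {H : α → ℂ → Mat N}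
    (h : ∀ a ∈ s, LoopIntegrable γ (H a)) :
    loopIntegral γ (fun t => ∑ a ∈ s, H a t) = ∑ a ∈ s, loopIntegral γ (H a) := by
  ext i j
  simp only [loopIntegral, Matrix.of_apply, Matrix.sum_apply, Finset.sum_mul]
  rw [intervalIntegral.integral_finsetSum fun a ha => h a ha i j, Finset.mul_sum]

/-! ### Cauchy transforms and divided differences -/

theorem hasMatDerivAt_cauchy (hF : LoopIntegrable γ F) {z : ℂ} (hz : z ∉ γ.trace) :
    HasMatDerivAt (fun z => loopIntegral γ fun t => (t - z)⁻¹ • F t)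
      (loopIntegral γ fun t => ((t - z) ^ 2)⁻¹ • F t) z := fun i j => by
  simp only [loopIntegral, Matrix.of_apply, Matrix.smul_apply, smul_eq_mul, mul_assoc]
  exact (hasDerivAt_integral_cauchy γ (hF i j) hz).const_mul _

/-- The entrywise divided difference `(G t - G z) / (t - z)`. -/
def divDiff {ι : Type} (G : ℂ → Matrix ι ι ℂ) (z t : ℂ) : Matrix ι ι ℂ :=
  Matrix.of fun i j => dslope (fun w => G w i j) z t

theorem divDiff_of_ne {ι : Type} (G : ℂ → Matrix ι ι ℂ) {z t : ℂ} (h : t ≠ z) :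
    divDiff G z t = (t - z)⁻¹ • (G t - G z) := by
  ext i j
  simp [divDiff, dslope_of_ne _ h, slope_def_field, div_eq_inv_mul]

theorem matEntire_loopIntegral_divDiff_mul (hG : MatEntire G) (hF : LoopIntegrable γ F) :
    MatEntire fun z => loopIntegral γ fun t => divDiff G z t * F t := fun i j => by
  have h : ∀ z, ∫ t in (0 : ℝ)..1, (divDiff G z (γ.toFun t) * F (γ.toFun t)) i j *
      deriv γ.toFun t = ∑ k, ∫ t in (0 : ℝ)..1, dslope (fun w => G w i k) z (γ.toFun t) *
      (F (γ.toFun t) k j * deriv γ.toFun t) := fun z => by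
    rw [← intervalIntegral.integral_finsetSum fun k _ => γ.intervalIntegrable_mul
      (differentiable_dslope (hG i k) z).continuous.continuousOn (hF k j)]
    simp only [divDiff, Matrix.mul_apply, Matrix.of_apply, Finset.sum_mul, mul_assoc]
  simp only [loopIntegral, Matrix.of_apply, h]
  exact (Differentiable.fun_sum fun k _ =>
    differentiable_integral_dslope γ (hG i k) (hF k j)).const_mul _

theorem matEntire_loopIntegral_mul_divDiff (hG : MatEntire G) (hF : LoopIntegrable γ F) :
    MatEntire fun z => loopIntegral γ fun t => F t * divDiff G z t := fun i j => by
  have h : ∀ z, ∫ t in (0 : ℝ)..1, (F (γ.toFun t) * divDiff G z (γ.toFun t)) i j *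
      deriv γ.toFun t = ∑ k, ∫ t in (0 : ℝ)..1, dslope (fun w => G w k j) z (γ.toFun t) *
      (F (γ.toFun t) i k * deriv γ.toFun t) := fun z => by
    rw [← intervalIntegral.integral_finsetSum fun k _ => γ.intervalIntegrable_mul
      (differentiable_dslope (hG k j) z).continuous.continuousOn (hF i k)]
    refine intervalIntegral.integral_congr fun t _ => ?_
    simp only [divDiff, Matrix.mul_apply, Matrix.of_apply, Finset.sum_mul]
    exact Finset.sum_congr rfl fun k _ => by ring
  simp only [loopIntegral, Matrix.of_apply, h]
  exact (Differentiable.fun_sum fun k _ =>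
    differentiable_integral_dslope γ (hG k j) (hF i k)).const_mul _

end LoopIntegral

/-! ### Cauchy transforms of a Pearson weight and the entire entries of the structure matrix -/

section Core

variable {N : ℕ} {γ : OriginLoop} {W hL hR : ℂ → Mat N} {U : Set ℂ} {WL WR : ℂ → Mat N}

theorem sub_ne_zero_of_mem_trace {z t : ℂ} (hz : z ∉ γ.trace) (ht : t ∈ γ.trace) : t - z ≠ 0 :=
  sub_ne_zero.2 fun h => hz (h ▸ ht)

theorem continuousOn_cauchyKernel {z : ℂ} (hz : z ∉ γ.trace) :
    ContinuousOn (fun t => (t - z)⁻¹) γ.trace :=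
  (continuousOn_id.sub continuousOn_const).inv₀ fun _ ht => sub_ne_zero_of_mem_trace hz ht

/-- Integration by parts along the loop against a weight that satisfies a Pearson equation. -/
theorem loopIntegral_by_parts (hW : LoopIntegrable γ W)
    (hLc : MatEntire hL) (hRc : MatEntire hR)
    (hF : IsPearsonFactorization γ W hL hR U WL WR) {G G' : ℂ → Mat N}
    (hG : ∀ z ∈ γ.trace, HasMatDerivAt G (G' z) z) (hG' : ContinuousOn G' γ.trace) :
    loopIntegral γ (fun t => G' t * (t ^ 2 • W t) +
      G t * ((2 * t) • W t + (hL t * W t + W t * hR t))) = 0 := by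
  have hV : LoopIntegrable γ fun t => hL t * W t + W t * hR t :=
    (hW.mul_left hLc.continuous.continuousOn).add (hW.mul_right hRc.continuous.continuousOn)
  have hu : ∀ z ∈ γ.trace \ {0}, HasMatDerivAt (fun z => WL z * WR z)
      (matDeriv WL z * WR z + WL z * matDeriv WR z) z := fun z hz =>
    (hF.left_holomorphic z (hF.trace_subset hz)).hasMatDerivAt.mul
      (hF.right_holomorphic z (hF.trace_subset hz)).hasMatDerivAt
  -- The two Pearson equations combine into `z² W' = h^L W + W h^R`, whose right-hand side is
  -- integrable on the loop.
  have huv : ∀ z ∈ γ.trace \ {0}, z ^ 2 • (matDeriv WL z * WR z + WL z * matDeriv WR z) =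
      hL z * W z + W z * hR z := fun z hz => by
    have hzU := hF.trace_subset hz
    rw [smul_add, ← smul_mul_assoc, hF.left_pearson z hzU, ← mul_smul_comm,
      hF.right_pearson z hzU, hF.factor z hz, mul_assoc, mul_assoc]
  have key : ∀ i j k, _ := fun i j k => γ.integral_by_parts (w := fun z => W z k j)
    (u := fun z => (WL z * WR z) k j)
    (u' := fun z => (matDeriv WL z * WR z + WL z * matDeriv WR z) k j)
    (v := fun z => (hL z * W z + W z * hR z) k j)
    (R := fun z => G z i k) (R' := fun z => G' z i k)
    (fun z hz => by rw [hF.factor z hz]) (fun z hz => hu z hz k j)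
    (fun z hz => by rw [← huv z hz]; rfl) (hW k j) (hV k j)
    (fun z hz => hG z hz i k) (continuousOn_matrix_entry hG' i k)
  ext i j
  have hsum : ∀ t : ℝ, (G' (γ.toFun t) * (γ.toFun t ^ 2 • W (γ.toFun t)) +
      G (γ.toFun t) * ((2 * γ.toFun t) • W (γ.toFun t) + (hL (γ.toFun t) * W (γ.toFun t) +
        W (γ.toFun t) * hR (γ.toFun t)))) i j * deriv γ.toFun t =
      ∑ k, (G' (γ.toFun t) i k * (γ.toFun t ^ 2 * W (γ.toFun t) k j) +
        G (γ.toFun t) i k * (2 * γ.toFun t * W (γ.toFun t) k j +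
          (hL (γ.toFun t) * W (γ.toFun t) + W (γ.toFun t) * hR (γ.toFun t)) k j)) *
        deriv γ.toFun t := fun t => by
    rw [Matrix.add_apply, Matrix.mul_apply, Matrix.mul_apply, ← Finset.sum_add_distrib,
      Finset.sum_mul]
    rfl
  simp only [loopIntegral, Matrix.of_apply, hsum, Matrix.zero_apply]
  rw [intervalIntegral.integral_finsetSum fun k _ => (key i j k).1,
    Finset.sum_eq_zero fun k _ => (key i j k).2, mul_zero]

theorem loopIntegral_divDiff_mul {G F : ℂ → Mat N} (hG : MatEntire G) (hF : LoopIntegrable γ F)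
    {z : ℂ} (hz : z ∉ γ.trace) :
    loopIntegral γ (fun t => divDiff G z t * F t) =
      loopIntegral γ (fun t => (t - z)⁻¹ • (G t * F t)) -
        G z * loopIntegral γ (fun t => (t - z)⁻¹ • F t) := by
  have hc := continuousOn_cauchyKernel hz
  rw [← loopIntegral_const_mul (hF.smul hc), ← loopIntegral_sub
    ((hF.mul_left hG.continuous.continuousOn).smul hc) ((hF.smul hc).mul_left continuousOn_const)]
  refine loopIntegral_congr fun t ht => ?_
  rw [divDiff_of_ne _ (sub_ne_zero.1 (sub_ne_zero_of_mem_trace hz ht)), smul_mul_assoc, sub_mul,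
    smul_sub, mul_smul_comm]

theorem loopIntegral_mul_divDiff {G F : ℂ → Mat N} (hG : MatEntire G) (hF : LoopIntegrable γ F)
    {z : ℂ} (hz : z ∉ γ.trace) :
    loopIntegral γ (fun t => F t * divDiff G z t) =
      loopIntegral γ (fun t => (t - z)⁻¹ • (F t * G t)) -
        loopIntegral γ (fun t => (t - z)⁻¹ • F t) * G z := by
  have hc := continuousOn_cauchyKernel hz
  rw [← loopIntegral_mul_const (hF.smul hc), ← loopIntegral_sub
    ((hF.mul_right hG.continuous.continuousOn).smul hc) ((hF.smul hc).mul_right continuousOn_const)]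
  refine loopIntegral_congr fun t ht => ?_
  rw [divDiff_of_ne _ (sub_ne_zero.1 (sub_ne_zero_of_mem_trace hz ht)), mul_smul_comm, mul_sub,
    smul_sub, smul_mul_assoc]

/-- The left Cauchy transform `∫_γ A(t) W(t) / (t - z) dt / (2 π i)`. -/
def cauchyL (γ : OriginLoop) (W A : ℂ → Mat N) (z : ℂ) : Mat N :=
  loopIntegral γ fun t => (t - z)⁻¹ • (A t * W t)

/-- The right Cauchy transform `∫_γ W(t) B(t) / (t - z) dt / (2 π i)`. -/
def cauchyR (γ : OriginLoop) (W B : ℂ → Mat N) (z : ℂ) : Mat N :=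
  loopIntegral γ fun t => (t - z)⁻¹ • (W t * B t)

/-- The derivative of the left Cauchy transform off the loop. -/
def cauchyLDeriv (γ : OriginLoop) (W A : ℂ → Mat N) (z : ℂ) : Mat N :=
  loopIntegral γ fun t => ((t - z) ^ 2)⁻¹ • (A t * W t)

theorem hasMatDerivAt_cauchyL (hW : LoopIntegrable γ W) {A : ℂ → Mat N} (hA : MatEntire A) {z : ℂ}
    (hz : z ∉ γ.trace) : HasMatDerivAt (cauchyL γ W A) (cauchyLDeriv γ W A z) z :=
  hasMatDerivAt_cauchy (hW.mul_left hA.continuous.continuousOn) hz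

theorem matDifferentiableAt_cauchyR (hW : LoopIntegrable γ W) {B : ℂ → Mat N} (hB : MatEntire B)
    {z : ℂ} (hz : z ∉ γ.trace) : MatDifferentiableAt (cauchyR γ W B) z :=
  (hasMatDerivAt_cauchy (hW.mul_right hB.continuous.continuousOn) hz).matDifferentiableAt

theorem cauchyL_zero (z : ℂ) : cauchyL γ W (fun _ => 0) z = 0 := by
  simp only [cauchyL, zero_mul, smul_zero, loopIntegral_zero]

theorem cauchyR_zero (z : ℂ) : cauchyR γ W (fun _ => 0) z = 0 := by
  simp only [cauchyR, mul_zero, smul_zero, loopIntegral_zero]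

theorem cauchyL_const_mul (hW : LoopIntegrable γ W) {A : ℂ → Mat N} (hA : MatEntire A) (K : Mat N)
    {z : ℂ} (hz : z ∉ γ.trace) :
    cauchyL γ W (fun t => K * A t) z = K * cauchyL γ W A z := by
  rw [cauchyL, cauchyL, ← loopIntegral_const_mul
    ((hW.mul_left hA.continuous.continuousOn).smul (continuousOn_cauchyKernel hz))]
  simp only [mul_assoc, mul_smul_comm]

theorem cauchyR_mul_const (hW : LoopIntegrable γ W) {B : ℂ → Mat N} (hB : MatEntire B) (K : Mat N)
    {z : ℂ} (hz : z ∉ γ.trace) :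
    cauchyR γ W (fun t => B t * K) z = cauchyR γ W B z * K := by
  rw [cauchyR, cauchyR, ← loopIntegral_mul_const
    ((hW.mul_right hB.continuous.continuousOn).smul (continuousOn_cauchyKernel hz))]
  simp only [mul_assoc, smul_mul_assoc]

/-- The commutator of the two Cauchy transforms is an integral of divided differences. -/
theorem cauchyL_mul_sub_mul_cauchyR (hW : LoopIntegrable γ W) {A B : ℂ → Mat N} (hA : MatEntire A)
    (hB : MatEntire B) {z : ℂ} (hz : z ∉ γ.trace) :
    cauchyL γ W A z * B z - A z * cauchyR γ W B z =
      loopIntegral γ (fun t => divDiff A z t * (W t * B t)) -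
        loopIntegral γ (fun t => A t * W t * divDiff B z t) := by
  rw [loopIntegral_divDiff_mul hA (hW.mul_right hB.continuous.continuousOn) hz,
    loopIntegral_mul_divDiff hB (hW.mul_left hA.continuous.continuousOn) hz, cauchyL, cauchyR]
  simp only [mul_assoc]
  abel

/-- The function `z² A'(z) + A(z) h(z)`. -/
def pearsonOp (h A : ℂ → Mat N) (z : ℂ) : Mat N := z ^ 2 • matDeriv A z + A z * h z

theorem matEntire_pearsonOp {h A : ℂ → Mat N} (hh : MatEntire h) (hA : MatEntire A) :
    MatEntire (pearsonOp h A) :=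
  (MatEntire.smul (by fun_prop) hA.matDeriv).add (hA.mul hh)

/-- Integrate the derivative of `(t - z)⁻¹ A t² W` along the loop. Since `t² / (t - z)² = z² / (t -
z)² + 2t / (t - z) - 1`, the `2t` term cancels the one from differentiating `t²`, and the `-1`
leaves the constant `∫ A W`. -/
theorem smul_cauchyLDeriv (hW : LoopIntegrable γ W) (hLc : MatEntire hL) (hRc : MatEntire hR)
    (hF : IsPearsonFactorization γ W hL hR U WL WR) {A : ℂ → Mat N} (hA : MatEntire A) {z : ℂ}
    (hz : z ∉ γ.trace) :
    z ^ 2 • cauchyLDeriv γ W A z = cauchyL γ W (pearsonOp hL A) z +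
      loopIntegral γ (fun t => (t - z)⁻¹ • (A t * W t * hR t)) +
      loopIntegral γ (fun t => A t * W t) := by
  have hc := continuousOn_cauchyKernel hz
  have hc2 : ContinuousOn (fun t => ((t - z) ^ 2)⁻¹) γ.trace := by
    exact (hc.pow 2).congr fun t _ => by simp [inv_pow]
  have hAW := hW.mul_left hA.continuous.continuousOn
  have i1 := (hW.mul_left (matEntire_pearsonOp hLc hA).continuous.continuousOn).smul hc
  have i2 := (hAW.mul_right hRc.continuous.continuousOn).smul hc
  have i3 := (hAW.smul hc2).smul (continuousOn_const (c := z ^ 2))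
  have h0 := loopIntegral_by_parts hW hLc hRc hF
    (G := fun t => (t - z)⁻¹ • A t)
    (G' := fun t => (-((t - z) ^ 2)⁻¹) • A t + (t - z)⁻¹ • matDeriv A t)
    (fun t ht => HasMatDerivAt.smul (by
      refine (((hasDerivAt_id' t).sub_const z).fun_inv
        (sub_ne_zero_of_mem_trace hz ht)).congr_deriv ?_
      rw [neg_div, one_div]) (hA.matDifferentiableAt t).hasMatDerivAt)
    ((hc2.neg.smul hA.continuous.continuousOn).add
      (hc.smul hA.matDeriv.continuous.continuousOn))
  rw [cauchyLDeriv, cauchyL, ← loopIntegral_smul, ← sub_eq_zero, ← loopIntegral_add i1 i2,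
    ← loopIntegral_add (i1.add i2) hAW, ← loopIntegral_sub i3 ((i1.add i2).add hAW),
    ← neg_eq_zero, ← h0, ← neg_one_smul ℂ, ← loopIntegral_smul]
  refine loopIntegral_congr fun t ht => ?_
  have hne := sub_ne_zero_of_mem_trace hz ht
  simp only [pearsonOp, mul_add, add_mul, smul_add, smul_mul_assoc, mul_smul_comm, mul_assoc,
    smul_smul]
  match_scalars <;> field

/-- The entry of the structure matrix that belongs to a row `(A, A W)` and a column `(- W B, B)`,
as an entire function. -/
def structureEntry (γ : OriginLoop) (W hL hR A B : ℂ → Mat N) (z : ℂ) : Mat N :=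
  loopIntegral γ (fun t => divDiff (pearsonOp hL A) z t * (W t * B t)) -
    loopIntegral γ (fun t => pearsonOp hL A t * W t * divDiff B z t) +
    loopIntegral γ (fun t => A t * W t * divDiff hR z t) * B z +
    loopIntegral γ (fun t => A t * W t) * B z

theorem matEntire_structureEntry (hW : LoopIntegrable γ W) (hLc : MatEntire hL)
    (hRc : MatEntire hR) {A B : ℂ → Mat N} (hA : MatEntire A) (hB : MatEntire B) :
    MatEntire (structureEntry γ W hL hR A B) := by
  have hG := matEntire_pearsonOp hLc hA
  exact (((matEntire_loopIntegral_divDiff_mul hG (hW.mul_right hB.continuous.continuousOn)).sub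
    (matEntire_loopIntegral_mul_divDiff hB (hW.mul_left hG.continuous.continuousOn))).add
    ((matEntire_loopIntegral_mul_divDiff hRc (hW.mul_left hA.continuous.continuousOn)).mul hB)).add
    ((matEntire_const _).mul hB)

/-- After integration by parts, the transform of `pearsonOp hL A` pairs with `cauchyR γ W B` as a
commutator, and the `hR` terms inside and outside the integral form a divided difference of `hR`. -/
theorem structureEntry_eq (hW : LoopIntegrable γ W) (hLc : MatEntire hL) (hRc : MatEntire hR)
    (hF : IsPearsonFactorization γ W hL hR U WL WR) {A B : ℂ → Mat N} (hA : MatEntire A)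
    (hB : MatEntire B) {z : ℂ} (hz : z ∉ γ.trace) :
    structureEntry γ W hL hR A B z = (z ^ 2 • cauchyLDeriv γ W A z) * B z -
      pearsonOp hL A z * cauchyR γ W B z - cauchyL γ W A z * hR z * B z := by
  have hAW := hW.mul_left hA.continuous.continuousOn
  rw [structureEntry, ← cauchyL_mul_sub_mul_cauchyR hW (matEntire_pearsonOp hLc hA) hB hz,
    loopIntegral_mul_divDiff hRc hAW hz, smul_cauchyLDeriv hW hLc hRc hF hA hz]
  simp only [cauchyL, add_mul, sub_mul]
  abel

/-- The entire continuation of `z² (Y' + Y diag(h^L, -h^R) / z²) X` for block matrices `Y`, `X` built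
from Cauchy transforms. -/
theorem exists_matEntire_structure (hW : LoopIntegrable γ W) (hLc : MatEntire hL)
    (hRc : MatEntire hR) (hF : IsPearsonFactorization γ W hL hR U WL WR)
    {A₁ A₂ B₁ B₂ : ℂ → Mat N} (hA₁ : MatEntire A₁) (hA₂ : MatEntire A₂) (hB₁ : MatEntire B₁)
    (hB₂ : MatEntire B₂) (K₁ K₂ J₁ J₂ : Mat N) {Y X : ℂ → BlockMat N}
    (hY : ∀ z ∉ γ.trace, Y z = Matrix.fromBlocks (A₁ z) (cauchyL γ W A₁ z + K₁)
      (A₂ z) (cauchyL γ W A₂ z + K₂))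
    (hX : ∀ z ∉ γ.trace, X z = Matrix.fromBlocks (J₁ - cauchyR γ W B₁ z) (J₂ - cauchyR γ W B₂ z)
      (B₁ z) (B₂ z)) :
    (∀ z ∉ γ.trace, MatDifferentiableAt Y z) ∧ (∀ z ∉ γ.trace, MatDifferentiableAt X z) ∧
    ∃ E : ℂ → BlockMat N, MatEntire E ∧ ∀ z ∉ γ.trace,
      (z ^ 2 • matDeriv Y z + Y z * Matrix.fromBlocks (hL z) 0 0 (-hR z)) * X z = E z := by
  have hev : ∀ z ∉ γ.trace, ∀ᶠ w in 𝓝 z, w ∉ γ.trace := fun z hz =>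
    γ.isClosed_trace.isOpen_compl.mem_nhds hz
  have hdiff : ∀ {A : ℂ → Mat N}, MatEntire A → ∀ z,
      HasMatDerivAt A (matDeriv A z) z := fun hA z => (hA.matDifferentiableAt z).hasMatDerivAt
  have hC : ∀ {A : ℂ → Mat N}, MatEntire A → ∀ (K : Mat N), ∀ z ∉ γ.trace,
      HasMatDerivAt (fun z => cauchyL γ W A z + K) (cauchyLDeriv γ W A z) z := fun hA K z hz => by
    simpa using (hasMatDerivAt_cauchyL hW hA hz).add (hasMatDerivAt_const K z)
  have hD : ∀ {B : ℂ → Mat N}, MatEntire B → ∀ (J : Mat N), ∀ z ∉ γ.trace,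
      HasMatDerivAt (fun z => J - cauchyR γ W B z) (-matDeriv (cauchyR γ W B) z) z :=
    fun hB J z hz => by
      simpa [sub_eq_add_neg] using (hasMatDerivAt_const J z).add
        (matDifferentiableAt_cauchyR hW hB hz).hasMatDerivAt.neg
  have hYd : ∀ z ∉ γ.trace, HasMatDerivAt Y (Matrix.fromBlocks (matDeriv A₁ z)
      (cauchyLDeriv γ W A₁ z) (matDeriv A₂ z) (cauchyLDeriv γ W A₂ z)) z := fun z hz =>
    (hasMatDerivAt_fromBlocks (hdiff hA₁ z) (hC hA₁ K₁ z hz) (hdiff hA₂ z) (hC hA₂ K₂ z hz)).congr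
      ((hev z hz).mono hY)
  have hXd : ∀ z ∉ γ.trace, MatDifferentiableAt X z := fun z hz =>
    ((hasMatDerivAt_fromBlocks (hD hB₁ J₁ z hz) (hD hB₂ J₂ z hz) (hdiff hB₁ z) (hdiff hB₂ z)).congr
      ((hev z hz).mono hX)).matDifferentiableAt
  -- The constants `K` and `J`, needed for the conventions at `n = 0`, contribute only entire terms.
  have hS : ∀ {A B : ℂ → Mat N}, MatEntire A → MatEntire B → ∀ K J : Mat N,
      MatEntire (fun z => structureEntry γ W hL hR A B z + pearsonOp hL A z * J - K * hR z * B z) :=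
    fun hA hB K J => ((matEntire_structureEntry hW hLc hRc hA hB).add
      ((matEntire_pearsonOp hLc hA).mul (matEntire_const J))).sub
      (((matEntire_const K).mul hRc).mul hB)
  refine ⟨fun z hz => (hYd z hz).matDifferentiableAt, hXd, _, matEntire_fromBlocks
    (hS hA₁ hB₁ K₁ J₁) (hS hA₁ hB₂ K₁ J₂) (hS hA₂ hB₁ K₂ J₁) (hS hA₂ hB₂ K₂ J₂), fun z hz => ?_⟩
  have hentry : ∀ {A B : ℂ → Mat N}, MatEntire A → MatEntire B → ∀ K J : Mat N,
      (z ^ 2 • matDeriv A z + A z * hL z) * (J - cauchyR γ W B z) +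
        (z ^ 2 • cauchyLDeriv γ W A z + -((cauchyL γ W A z + K) * hR z)) * B z =
      structureEntry γ W hL hR A B z + pearsonOp hL A z * J - K * hR z * B z := fun hA hB K J => by
    rw [structureEntry_eq hW hLc hRc hF hA hB hz, pearsonOp]
    simp only [add_mul, mul_sub, neg_mul]
    abel
  rw [(hYd z hz).matDeriv, hY z hz, hX z hz, Matrix.fromBlocks_smul, Matrix.fromBlocks_multiply,
    Matrix.fromBlocks_add, Matrix.fromBlocks_multiply]
  simp only [mul_zero, add_zero, zero_add, mul_neg]
  rw [hentry hA₁ hB₁ K₁ J₁, hentry hA₁ hB₂ K₁ J₂, hentry hA₂ hB₁ K₂ J₁, hentry hA₂ hB₂ K₂ J₂]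

end Core

/-! ### Divided differences of matrix polynomials against orthogonality -/

section Polynomials

variable {N : ℕ} {γ : OriginLoop} {W : ℂ → Mat N}

theorem polyVal_eq_sum {P : Polynomial (Mat N)} {n : ℕ} (h : P.natDegree < n) (z : ℂ) :
    polyVal P z = ∑ k ∈ Finset.range n, z ^ k • P.coeff k := by
  rw [polyVal, Polynomial.eval_eq_sum_range' h]
  refine Finset.sum_congr rfl fun k _ => ?_
  rw [← map_pow, Matrix.scalar_apply, ← Matrix.smul_one_eq_diagonal, mul_smul_comm, mul_one]

theorem matEntire_polyVal (P : Polynomial (Mat N)) : MatEntire (polyVal P) := by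
  have := matEntire_sum (Finset.range (P.natDegree + 1)) fun k _ =>
    MatEntire.smul (c := fun z => z ^ k) (by fun_prop) (matEntire_const (P.coeff k))
  simpa only [← polyVal_eq_sum (Nat.lt_succ_self _)] using this

theorem divDiff_polyVal {P : Polynomial (Mat N)} {n : ℕ} (h : P.natDegree < n) {z t : ℂ}
    (hzt : t ≠ z) : divDiff (polyVal P) z t =
      ∑ k ∈ Finset.range n, ∑ i ∈ Finset.range k, z ^ (k - 1 - i) • t ^ i • P.coeff k := by
  rw [divDiff_of_ne _ hzt, polyVal_eq_sum h, polyVal_eq_sum h, ← Finset.sum_sub_distrib,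
    Finset.smul_sum]
  refine Finset.sum_congr rfl fun k _ => ?_
  rw [← sub_smul, ← geom_sum₂_mul t z k, smul_smul, mul_comm, mul_assoc,
    mul_inv_cancel₀ (sub_ne_zero.2 hzt), mul_one, Finset.sum_smul]
  refine Finset.sum_congr rfl fun i _ => ?_
  rw [smul_smul, mul_comm]

/-- The index `i = n` is reached only for `k = n + 1`, where the exponent of `z` is `0`; hence the
answer does not depend on `z`. -/
theorem sum_range_ite_eq {V : Type*} [AddCommGroup V] [Module ℂ V] (n : ℕ) (z : ℂ) (v : ℕ → V) :
    ∑ k ∈ Finset.range (n + 2), ∑ i ∈ Finset.range k,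
      z ^ (k - 1 - i) • (if i = n then v k else 0) = v (n + 1) := by
  rw [Finset.sum_range_succ, Finset.sum_range_succ, Finset.sum_eq_zero, Finset.sum_eq_zero]
  · simp
  · intro i hi
    rw [if_neg (Finset.mem_range.1 hi).ne, smul_zero]
  · intro k hk
    refine Finset.sum_eq_zero fun i hi => ?_
    rw [if_neg, smul_zero]
    have := Finset.mem_range.1 hk
    have := Finset.mem_range.1 hi
    omega

/-- The divided difference has degree at most `n` in `t`, and its coefficient of `t ^ n` is `P.coeff
(n + 1)`; orthogonality kills all lower powers. -/
theorem loopIntegral_mul_divDiff_polyVal {F : ℂ → Mat N} (hF : LoopIntegrable γ F) {n : ℕ}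
    {K : Mat N} (hK : ∀ k ≤ n, loopIntegral γ (fun t => t ^ k • F t) = if k = n then K else 0)
    {P : Polynomial (Mat N)} (hP : P.natDegree ≤ n + 1) {z : ℂ} (hz : z ∉ γ.trace) :
    loopIntegral γ (fun t => F t * divDiff (polyVal P) z t) = K * P.coeff (n + 1) := by
  have hi : ∀ k i, LoopIntegrable γ fun t => z ^ (k - 1 - i) • (t ^ i • F t * P.coeff k) :=
    fun k i => ((hF.smul (by fun_prop)).mul_right continuousOn_const).smul continuousOn_const
  have hs : ∀ k, LoopIntegrable γ fun t => ∑ i ∈ Finset.range k,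
      z ^ (k - 1 - i) • (t ^ i • F t * P.coeff k) := fun k => LoopIntegrable.sum _ fun i _ => hi k i
  rw [loopIntegral_congr (G := fun t => ∑ k ∈ Finset.range (n + 2), ∑ i ∈ Finset.range k,
      z ^ (k - 1 - i) • (t ^ i • F t * P.coeff k)), loopIntegral_sum _ fun k _ => hs k,
      ← sum_range_ite_eq n z fun k => K * P.coeff k]
  · refine Finset.sum_congr rfl fun k hk => ?_
    rw [loopIntegral_sum _ fun i _ => hi k i]
    refine Finset.sum_congr rfl fun i hik => ?_
    have hin : i ≤ n := by
      have := Finset.mem_range.1 hk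
      have := Finset.mem_range.1 hik
      omega
    rw [loopIntegral_smul, loopIntegral_mul_const (hF.smul (by fun_prop)), hK i hin, ite_mul,
      zero_mul]
  · intro t ht
    rw [divDiff_polyVal (Nat.lt_succ_of_le hP) (sub_ne_zero.1 (sub_ne_zero_of_mem_trace hz ht)),
      Finset.mul_sum]
    refine Finset.sum_congr rfl fun k _ => ?_
    rw [Finset.mul_sum]
    refine Finset.sum_congr rfl fun i _ => ?_
    simp only [mul_smul_comm, smul_mul_assoc]

theorem loopIntegral_divDiff_polyVal_mul {F : ℂ → Mat N} (hF : LoopIntegrable γ F) {n : ℕ}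
    {K : Mat N} (hK : ∀ k ≤ n, loopIntegral γ (fun t => t ^ k • F t) = if k = n then K else 0)
    {P : Polynomial (Mat N)} (hP : P.natDegree ≤ n + 1) {z : ℂ} (hz : z ∉ γ.trace) :
    loopIntegral γ (fun t => divDiff (polyVal P) z t * F t) = P.coeff (n + 1) * K := by
  have hi : ∀ k i, LoopIntegrable γ fun t => z ^ (k - 1 - i) • (P.coeff k * t ^ i • F t) :=
    fun k i => ((hF.smul (by fun_prop)).mul_left continuousOn_const).smul continuousOn_const
  have hs : ∀ k, LoopIntegrable γ fun t => ∑ i ∈ Finset.range k,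
      z ^ (k - 1 - i) • (P.coeff k * t ^ i • F t) := fun k => LoopIntegrable.sum _ fun i _ => hi k i
  rw [loopIntegral_congr (G := fun t => ∑ k ∈ Finset.range (n + 2), ∑ i ∈ Finset.range k,
      z ^ (k - 1 - i) • (P.coeff k * t ^ i • F t)), loopIntegral_sum _ fun k _ => hs k,
      ← sum_range_ite_eq n z fun k => P.coeff k * K]
  · refine Finset.sum_congr rfl fun k hk => ?_
    rw [loopIntegral_sum _ fun i _ => hi k i]
    refine Finset.sum_congr rfl fun i hik => ?_
    have hin : i ≤ n := by
      have := Finset.mem_range.1 hk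
      have := Finset.mem_range.1 hik
      omega
    rw [loopIntegral_smul, loopIntegral_const_mul (hF.smul (by fun_prop)), hK i hin, mul_ite,
      mul_zero]
  · intro t ht
    rw [divDiff_polyVal (Nat.lt_succ_of_le hP) (sub_ne_zero.1 (sub_ne_zero_of_mem_trace hz ht)),
      Finset.sum_mul]
    refine Finset.sum_congr rfl fun k _ => ?_
    rw [Finset.sum_mul]
    refine Finset.sum_congr rfl fun i _ => ?_
    simp only [mul_smul_comm, smul_mul_assoc]

end Polynomials

/-! ### The explicit inverse of the left fundamental block matrix -/

section Inverse

variable {N : ℕ} {γ : OriginLoop} {W : ℂ → Mat N} {PL PR : ℕ → Polynomial (Mat N)} {C : ℕ → Mat N}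

/-- For degrees differing by at most one, both divided differences are within reach of
orthogonality, so the commutator is constant: `0` for `m = n`, `(C n)⁻¹` for `m = n + 1`, and `-(C
m)⁻¹` for `n = m + 1`. -/
theorem IsBiorthogonal.cauchy_commutator (h : IsBiorthogonal γ W PL PR C) (hW : LoopIntegrable γ W)
    {m n : ℕ} (hmn : m ≤ n + 1) (hnm : n ≤ m + 1) {z : ℂ} (hz : z ∉ γ.trace) :
    cauchyL γ W (polyVal (PL m)) z * polyVal (PR n) z -
      polyVal (PL m) z * cauchyR γ W (polyVal (PR n)) z =
      (PL m).coeff (n + 1) * (C n)⁻¹ - (C m)⁻¹ * (PR n).coeff (m + 1) := by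
  have hL := matEntire_polyVal (PL m)
  have hR := matEntire_polyVal (PR n)
  rw [cauchyL_mul_sub_mul_cauchyR hW hL hR hz,
    loopIntegral_divDiff_polyVal_mul (hW.mul_right hR.continuous.continuousOn)
      (h.right_orthogonal n) ((h.left_monic m).2.trans_le hmn) hz,
    loopIntegral_mul_divDiff_polyVal (hW.mul_left hL.continuous.continuousOn)
      (h.left_orthogonal m) ((h.right_monic n).2.trans_le hnm) hz]

theorem coeff_eq_one_of_monic {P : Polynomial (Mat N)} {n : ℕ} (h : P.Monic ∧ P.natDegree = n) :
    P.coeff n = 1 := by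
  rw [← h.2]; exact h.1

theorem coeff_eq_zero_of_monic {P : Polynomial (Mat N)} {n m : ℕ} (h : P.Monic ∧ P.natDegree = n)
    (hm : n < m) : P.coeff m = 0 :=
  Polynomial.coeff_eq_zero_of_natDegree_lt (h.2.trans_lt hm)

theorem IsBiorthogonal.polyVal_left_zero (h : IsBiorthogonal γ W PL PR C) (z : ℂ) :
    polyVal (PL 0) z = 1 := by
  rw [polyVal_eq_sum (n := 1) (by rw [(h.left_monic 0).2]; exact one_pos)]
  simp [coeff_eq_one_of_monic (h.left_monic 0)]

theorem IsBiorthogonal.polyVal_right_zero (h : IsBiorthogonal γ W PL PR C) (z : ℂ) :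
    polyVal (PR 0) z = 1 := by
  rw [polyVal_eq_sum (n := 1) (by rw [(h.right_monic 0).2]; exact one_pos)]
  simp [coeff_eq_one_of_monic (h.right_monic 0)]

/-- The symplectic unit. -/
def sympl (N : ℕ) : BlockMat N := Matrix.fromBlocks 0 1 (-1) 0

theorem sympl_mul_neg : sympl N * -sympl N = 1 := by
  rw [sympl, Matrix.fromBlocks_neg, Matrix.fromBlocks_multiply]
  simp

theorem neg_mul_sympl : -sympl N * sympl N = 1 := by
  rw [sympl, Matrix.fromBlocks_neg, Matrix.fromBlocks_multiply]
  simp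

theorem sympl_conj (A B D E : Mat N) :
    sympl N * Matrix.fromBlocks A B D E * -sympl N = Matrix.fromBlocks E (-D) (-B) A := by
  rw [sympl, Matrix.fromBlocks_neg, Matrix.fromBlocks_multiply, Matrix.fromBlocks_multiply]
  simp

/-- Each block of the product is, up to factors `C n`, a commutator of Cauchy transforms: adjacent
degrees give the diagonal blocks and equal degrees the vanishing ones. At `n = 0` both polynomials
are `1` and the two second kind functions coincide. -/
theorem IsBiorthogonal.YL_mul_YR (h : IsBiorthogonal γ W PL PR C) (hW : LoopIntegrable γ W) (n : ℕ)
    {z : ℂ} (hz : z ∉ γ.trace) :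
    YL γ W PL C n z * (sympl N * YR γ W PR C n z * -sympl N) = 1 := by
  rcases n with _ | n
  · have h0 := h.cauchy_commutator hW (m := 0) (n := 0) (by simp) (by simp) hz
    rw [coeff_eq_zero_of_monic (h.left_monic 0) (Nat.lt_succ_self 0),
      coeff_eq_zero_of_monic (h.right_monic 0) (Nat.lt_succ_self 0), h.polyVal_left_zero,
      h.polyVal_right_zero] at h0
    simp only [mul_one, one_mul, zero_mul, mul_zero, sub_zero] at h0
    have h1 : secondKindL γ W (PL 0) z - secondKindR γ W (PR 0) z = 0 := h0
    rw [YL, YR, sympl_conj, Matrix.fromBlocks_multiply, h.polyVal_left_zero, h.polyVal_right_zero,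
      ← Matrix.fromBlocks_one]
    congr 1 <;> simp
    rw [← h1]; abel
  · have hL : ∀ k, polyVal (PL k) z * secondKindR γ W (PR k) z =
        secondKindL γ W (PL k) z * polyVal (PR k) z := fun k => by
      have := h.cauchy_commutator hW (m := k) (n := k) (by simp) (by simp) hz
      rw [coeff_eq_zero_of_monic (h.left_monic k) (Nat.lt_succ_self k),
        coeff_eq_zero_of_monic (h.right_monic k) (Nat.lt_succ_self k), zero_mul, mul_zero,
        sub_zero] at this
      exact (sub_eq_zero.1 this).symm
    have h1 : secondKindL γ W (PL (n + 1)) z * polyVal (PR n) z -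
        polyVal (PL (n + 1)) z * secondKindR γ W (PR n) z = (C n)⁻¹ := by
      have := h.cauchy_commutator hW (m := n + 1) (n := n) (by simp) (by omega) hz
      rw [coeff_eq_one_of_monic (h.left_monic (n + 1)),
        coeff_eq_zero_of_monic (h.right_monic n) (by omega), one_mul, mul_zero, sub_zero] at this
      exact this
    have h2 : polyVal (PL n) z * secondKindR γ W (PR (n + 1)) z -
        secondKindL γ W (PL n) z * polyVal (PR (n + 1)) z = (C n)⁻¹ := by
      have := h.cauchy_commutator hW (m := n) (n := n + 1) (by omega) (by simp) hz
      rw [coeff_eq_one_of_monic (h.right_monic (n + 1)),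
        coeff_eq_zero_of_monic (h.left_monic n) (by omega), zero_mul, mul_one, zero_sub,
        ← neg_eq_iff_eq_neg, neg_sub] at this
      exact this
    have hC : IsUnit (C n).det := (Matrix.isUnit_iff_isUnit_det _).1 (h.nonsingular n)
    rw [YL, YR, sympl_conj, Matrix.fromBlocks_multiply, ← Matrix.fromBlocks_one]
    congr 1
    · calc _ = (secondKindL γ W (PL (n + 1)) z * polyVal (PR n) z -
            polyVal (PL (n + 1)) z * secondKindR γ W (PR n) z) * C n := by noncomm_ring
        _ = 1 := by rw [h1, Matrix.nonsing_inv_mul _ hC]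
    · rw [mul_neg, hL, neg_add_cancel]
    · calc _ = C n * (polyVal (PL n) z * secondKindR γ W (PR n) z -
            secondKindL γ W (PL n) z * polyVal (PR n) z) * C n := by noncomm_ring
        _ = 0 := by rw [hL, sub_self, mul_zero, zero_mul]
    · calc _ = C n * (polyVal (PL n) z * secondKindR γ W (PR (n + 1)) z -
            secondKindL γ W (PL n) z * polyVal (PR (n + 1)) z) := by noncomm_ring
        _ = 1 := by rw [h2, Matrix.mul_nonsing_inv _ hC]

variable {hL hR : ℂ → Mat N} {U : Set ℂ} {WL WR : ℂ → Mat N}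

theorem exists_matEntire_structure_YL (PL PR : ℕ → Polynomial (Mat N)) (C : ℕ → Mat N)
    (hW : LoopIntegrable γ W) (hLc : MatEntire hL) (hRc : MatEntire hR)
    (hF : IsPearsonFactorization γ W hL hR U WL WR) (n : ℕ) :
    (∀ z ∉ γ.trace, MatDifferentiableAt (YL γ W PL C n) z) ∧
    (∀ z ∉ γ.trace, MatDifferentiableAt (fun z => sympl N * YR γ W PR C n z * -sympl N) z) ∧
    ∃ E : ℂ → BlockMat N, MatEntire E ∧ ∀ z ∉ γ.trace,
      (z ^ 2 • matDeriv (YL γ W PL C n) z + YL γ W PL C n z *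
        Matrix.fromBlocks (hL z) 0 0 (-hR z)) * (sympl N * YR γ W PR C n z * -sympl N) = E z := by
  rcases n with _ | n
  -- The row `(0, I)` is the choice `A₂ = 0`, `K₂ = 1`; the first block column of the inverse is
  -- likewise `B₁ = 0`, `J₁ = 1`.
  · refine exists_matEntire_structure hW hLc hRc hF (matEntire_polyVal (PL 0))
      (matEntire_const 0) (matEntire_const 0) (matEntire_polyVal (PR 0)) 0 1 1 0
      (fun z hz => ?_) fun z hz => ?_
    · rw [YL, cauchyL_zero, zero_add, add_zero]; rfl
    · rw [YR, sympl_conj, cauchyR_zero, neg_zero, sub_zero, zero_sub]; rfl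
  · have hL := matEntire_polyVal (PL n)
    have hR := matEntire_polyVal (PR n)
    refine exists_matEntire_structure hW hLc hRc hF (matEntire_polyVal (PL (n + 1)))
      ((matEntire_const (-C n)).mul hL) (hR.mul (matEntire_const (C n)))
      (matEntire_polyVal (PR (n + 1))) 0 0 0 0 (fun z hz => ?_) fun z hz => ?_
    · rw [YL, cauchyL_const_mul hW hL _ hz, add_zero, add_zero, neg_mul, neg_mul]; rfl
    · rw [YR, sympl_conj, cauchyR_mul_const hW hR _ hz, neg_neg, zero_sub, zero_sub]; rfl

end Inverse

/-! ### Existence of the biorthogonal polynomials from the Hankel matrices -/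

section Existence

variable {N : ℕ} {γ : OriginLoop} {W : ℂ → Mat N}

theorem exists_monic_coeff (hN : 1 ≤ N) (n : ℕ) (a : ℕ → Mat N) (ha : a n = 1) :
    ∃ P : Polynomial (Mat N), (P.Monic ∧ P.natDegree = n) ∧ ∀ k ≤ n, P.coeff k = a k := by
  -- Over the zero ring every polynomial has `natDegree` equal to `0`; `N ≥ 1` excludes this.
  have : NeZero N := ⟨by omega⟩
  set P : Polynomial (Mat N) := ∑ k ∈ Finset.range (n + 1), Polynomial.monomial k (a k) with hP
  have hc : ∀ k ≤ n, P.coeff k = a k := fun k hk => by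
    rw [hP, Polynomial.finsetSum_coeff]
    simp only [Polynomial.coeff_monomial]
    rw [Finset.sum_ite_eq' (Finset.range (n + 1)), if_pos (Finset.mem_range.2 (Nat.lt_succ_of_le hk))]
  have hd : P.natDegree ≤ n := Polynomial.natDegree_sum_le_of_forall_le _ _ fun k hk =>
    (Polynomial.natDegree_monomial_le _).trans (Nat.lt_succ_iff.1 (Finset.mem_range.1 hk))
  have h1 : P.coeff n = 1 := (hc n le_rfl).trans ha
  exact ⟨P, ⟨Polynomial.monic_of_natDegree_le_of_coeff_eq_one n hd h1,
    le_antisymm hd (Polynomial.le_natDegree_of_ne_zero (by rw [h1]; exact one_ne_zero))⟩, hc⟩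

theorem loopIntegral_pow_smul_polyVal_mul (hW : LoopIntegrable γ W) {P : Polynomial (Mat N)} {n : ℕ}
    (hP : P.natDegree = n) (k : ℕ) : loopIntegral γ (fun z => z ^ k • (polyVal P z * W z)) =
      ∑ i ∈ Finset.range (n + 1), P.coeff i * moment γ W (i + k) := by
  have hi : ∀ j, LoopIntegrable γ fun t => t ^ j • W t := fun j => hW.smul (by fun_prop)
  have h : ∀ z ∈ γ.trace, z ^ k • (polyVal P z * W z) =
      ∑ i ∈ Finset.range (n + 1), P.coeff i * z ^ (i + k) • W z := fun z _ => by
    rw [polyVal_eq_sum (n := n + 1) (by omega), Finset.sum_mul, Finset.smul_sum]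
    refine Finset.sum_congr rfl fun i _ => ?_
    rw [smul_mul_assoc, smul_smul, mul_smul_comm, pow_add, mul_comm]
  rw [loopIntegral_congr h, loopIntegral_sum _ fun i _ => (hi (i + k)).mul_left continuousOn_const]
  exact Finset.sum_congr rfl fun i _ => loopIntegral_const_mul (hi (i + k)) _

theorem loopIntegral_pow_smul_mul_polyVal (hW : LoopIntegrable γ W) {P : Polynomial (Mat N)} {n : ℕ}
    (hP : P.natDegree = n) (k : ℕ) : loopIntegral γ (fun z => z ^ k • (W z * polyVal P z)) =
      ∑ i ∈ Finset.range (n + 1), moment γ W (k + i) * P.coeff i := by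
  have hi : ∀ j, LoopIntegrable γ fun t => t ^ j • W t := fun j => hW.smul (by fun_prop)
  have h : ∀ z ∈ γ.trace, z ^ k • (W z * polyVal P z) =
      ∑ i ∈ Finset.range (n + 1), (z ^ (k + i) • W z) * P.coeff i := fun z _ => by
    rw [polyVal_eq_sum (n := n + 1) (by omega), Finset.mul_sum, Finset.smul_sum]
    refine Finset.sum_congr rfl fun i _ => ?_
    rw [mul_smul_comm, smul_smul, smul_mul_assoc, pow_add]
  rw [loopIntegral_congr h, loopIntegral_sum _ fun i _ => (hi (k + i)).mul_right continuousOn_const]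
  exact Finset.sum_congr rfl fun i _ => loopIntegral_mul_const (hi (k + i)) _

/-- The `N × N` block of the inverse of the Hankel matrix at block position `(a, b)`. -/
def invBlock (γ : OriginLoop) (W : ℂ → Mat N) (n : ℕ) (a b : Fin (n + 1)) : Mat N :=
  Matrix.of fun i j => (hankel γ W n)⁻¹ (a, i) (b, j)

theorem sum_invBlock_mul_moment (hReg : IsRegular γ W) (n : ℕ) (a b : Fin (n + 1)) :
    ∑ c : Fin (n + 1), invBlock γ W n a c * moment γ W (c + b) = if a = b then 1 else 0 := by
  have h := Matrix.nonsing_inv_mul _ (hReg.2 n).isUnit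
  ext i j
  have h1 := congrFun (congrFun h (a, i)) (b, j)
  rw [Matrix.mul_apply, Fintype.sum_prod_type] at h1
  simp only [Matrix.sum_apply, Matrix.mul_apply]
  refine h1.trans ?_
  rw [Matrix.one_apply]
  split_ifs with h2 h3 h3 <;> simp_all [Matrix.one_apply]

theorem sum_moment_mul_invBlock (hReg : IsRegular γ W) (n : ℕ) (a b : Fin (n + 1)) :
    ∑ c : Fin (n + 1), moment γ W (a + c) * invBlock γ W n c b = if a = b then 1 else 0 := by
  have h := Matrix.mul_nonsing_inv _ (hReg.2 n).isUnit
  ext i j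
  have h1 := congrFun (congrFun h (a, i)) (b, j)
  rw [Matrix.mul_apply, Fintype.sum_prod_type] at h1
  simp only [Matrix.sum_apply, Matrix.mul_apply]
  refine h1.trans ?_
  rw [Matrix.one_apply]
  split_ifs with h2 h3 h3 <;> simp_all [Matrix.one_apply]

/-- The corner block of the inverse Hankel matrix is nonsingular. -/
theorem isUnit_invBlock_last (hReg : IsRegular γ W) (n : ℕ) :
    IsUnit (invBlock γ W n (Fin.last n) (Fin.last n)) := by
  rw [Matrix.isUnit_iff_isUnit_det, isUnit_iff_ne_zero]
  intro hdet
  obtain ⟨v, hv, hv0⟩ := Matrix.exists_vecMul_eq_zero_iff.2 hdet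
  -- For a left null vector `v` of the corner block, `x` is `v` times the last block row of the
  -- inverse, so `x` times the Hankel matrix is `v` in the last block and `0` elsewhere. The last
  -- block of `x` vanishes, hence the rest is annihilated by the next smaller Hankel matrix;
  -- regularity of that matrix gives `x = 0`, and so `v = 0`.
  set x : Fin (n + 1) → Fin N → ℂ :=
    fun c => Matrix.vecMul v (invBlock γ W n (Fin.last n) c) with hx
  have hxH : ∀ b : Fin (n + 1), ∑ c : Fin (n + 1), Matrix.vecMul (x c) (moment γ W (c + b)) =
      if Fin.last n = b then v else 0 := fun b => by
    simp only [hx, Matrix.vecMul_vecMul]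
    rw [← Matrix.vecMul_sum, sum_invBlock_mul_moment hReg]
    split_ifs <;> simp
  have hlast : x (Fin.last n) = 0 := hv0
  have hzero : ∀ c, x c = 0 := by
    rcases n with _ | m
    · intro c
      rwa [show c = Fin.last 0 from Fin.ext (by omega)]
    · have h0 : Matrix.vecMul (fun p : Fin (m + 1) × Fin N => x p.1.castSucc p.2)
          (hankel γ W m) = 0 := by
        ext ⟨b, j⟩
        have h1 := congrFun (hxH b.castSucc) j
        rw [if_neg (Fin.castSucc_lt_last b).ne', Fin.sum_univ_castSucc, hlast, Matrix.zero_vecMul,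
          add_zero, Finset.sum_apply] at h1
        rw [Matrix.vecMul, dotProduct, Fintype.sum_prod_type]
        exact h1
      have h2 := Matrix.eq_zero_of_vecMul_eq_zero (hReg.2 m) h0
      intro c
      refine Fin.lastCases hlast (fun b => ?_) c
      ext j
      exact congrFun h2 (b, j)
  have := hxH (Fin.last n)
  simp only [hzero, Matrix.zero_vecMul, Finset.sum_const_zero, if_true] at this
  exact hv this.symm

/-- The last block row and last block column of the inverse Hankel matrix, normalized to be monic by
the inverse of their common corner block, are the coefficients of the left and right polynomials.
That shared corner is why one `C n` serves both sides. -/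
theorem exists_isBiorthogonal (hN : 1 ≤ N) (hReg : IsRegular γ W) :
    ∃ (PL PR : ℕ → Polynomial (Mat N)) (C : ℕ → Mat N), IsBiorthogonal γ W PL PR C := by
  set C : ℕ → Mat N := fun n => invBlock γ W n (Fin.last n) (Fin.last n) with hC
  have hCu : ∀ n, IsUnit (C n) := isUnit_invBlock_last hReg
  have hCdet : ∀ n, IsUnit (C n).det := fun n => (Matrix.isUnit_iff_isUnit_det _).1 (hCu n)
  have hlast : ∀ n k (hk : k < n + 1), (Fin.last n = ⟨k, hk⟩) ↔ k = n := fun n k hk => by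
    rw [Fin.ext_iff, Fin.val_last, eq_comm]
  choose PL hPL hPLc using fun n => exists_monic_coeff hN n
    (fun k => if hk : k < n + 1 then (C n)⁻¹ * invBlock γ W n (Fin.last n) ⟨k, hk⟩ else 0)
    (by rw [dif_pos (Nat.lt_succ_self n)]; exact Matrix.nonsing_inv_mul _ (hCdet n))
  choose PR hPR hPRc using fun n => exists_monic_coeff hN n
    (fun k => if hk : k < n + 1 then invBlock γ W n ⟨k, hk⟩ (Fin.last n) * (C n)⁻¹ else 0)
    (by rw [dif_pos (Nat.lt_succ_self n)]; exact Matrix.mul_nonsing_inv _ (hCdet n))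
  refine ⟨PL, PR, C, hPL, hPR, hCu, fun n k hk => ?_, fun n k hk => ?_⟩
  · have hk' : k < n + 1 := Nat.lt_succ_of_le hk
    rw [loopIntegral_pow_smul_polyVal_mul hReg.1 (hPL n).2, Finset.sum_range]
    have := congrArg ((C n)⁻¹ * ·) (sum_invBlock_mul_moment hReg n (Fin.last n) ⟨k, hk'⟩)
    simp only [Finset.mul_sum, hlast, mul_ite, mul_one, mul_zero, ← mul_assoc] at this
    rw [← this]
    refine Finset.sum_congr rfl fun i _ => ?_
    rw [hPLc n i (Nat.lt_succ_iff.1 i.2), dif_pos i.2]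
  · have hk' : k < n + 1 := Nat.lt_succ_of_le hk
    rw [loopIntegral_pow_smul_mul_polyVal hReg.1 (hPR n).2, Finset.sum_range]
    have := congrArg (· * (C n)⁻¹) (sum_moment_mul_invBlock hReg n ⟨k, hk'⟩ (Fin.last n))
    simp only [Finset.sum_mul, eq_comm (b := Fin.last n), hlast, ite_mul, one_mul, zero_mul,
      mul_assoc] at this
    rw [← this]
    refine Finset.sum_congr rfl fun i _ => ?_
    rw [hPRc n i (Nat.lt_succ_iff.1 i.2), dif_pos i.2]

end Existence

/-! ### Double poles and the differential equation of the diagonal factor -/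

section Structure

/-- The continuation is `z⁻² E`: its order at `0` is `-2` plus the nonnegative order of an entry of
`E`. -/
theorem isMeromorphicWithDoublePole_of_matEntire {ι : Type} {F E : ℂ → Matrix ι ι ℂ} {D : Set ℂ}
    (hE : MatEntire E) (h0 : (0 : ℂ) ∉ D) (h : ∀ z ∈ D, z ^ 2 • F z = E z) :
    IsMeromorphicWithDoublePole F D := by
  have hinv : ∀ z : ℂ, MeromorphicAt (fun z : ℂ => (z ^ 2)⁻¹) z := fun z =>
    ((MeromorphicAt.id z).pow 2).inv
  have hEa : ∀ i j z, AnalyticAt ℂ (fun w => E w i j) z := fun i j z =>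
    (hE i j).analyticAt z
  refine ⟨fun z => (z ^ 2)⁻¹ • E z, E, fun z hz => ?_, fun i j z _ => ?_, fun z hz i j => ?_,
    fun i j => ?_, hE, fun z hz => ?_⟩
  · have hz0 : z ^ 2 ≠ 0 := pow_ne_zero 2 fun h => h0 (h ▸ hz)
    change (z ^ 2)⁻¹ • E z = F z
    rw [← h z hz, smul_smul, inv_mul_cancel₀ hz0, one_smul]
  · exact (hinv z).mul (hEa i j z).meromorphicAt
  · exact ((differentiableAt_id.pow 2).inv (pow_ne_zero 2 hz)).mul (hE i j z)
  · have h2 : meromorphicOrderAt (fun z : ℂ => (z ^ 2)⁻¹) 0 = ((-2 : ℤ) : WithTop ℤ) := by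
      rw [meromorphicOrderAt_eq_int_iff (hinv 0)]
      refine ⟨fun _ => 1, analyticAt_const, one_ne_zero, ?_⟩
      filter_upwards with z
      simp [zpow_neg]
    have h3 := meromorphicOrderAt_mul (hinv 0) (hEa i j 0).meromorphicAt
    change _ ≤ meromorphicOrderAt ((fun z : ℂ => (z ^ 2)⁻¹) * fun z => E z i j) 0
    rw [h3, h2]
    exact le_add_of_nonneg_right (hEa i j 0).meromorphicOrderAt_nonneg
  · rw [smul_smul, mul_inv_cancel₀ (pow_ne_zero 2 hz), one_smul]

variable {N : ℕ} {A B : Mat N}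

theorem isUnit_fromBlocks_diag (hA : IsUnit A) (hB : IsUnit B) :
    IsUnit (Matrix.fromBlocks A 0 0 B) := by
  rw [Matrix.isUnit_iff_isUnit_det] at *
  rw [Matrix.det_fromBlocks_zero₂₁]
  exact hA.mul hB

variable {γ : OriginLoop} {W hL hR : ℂ → Mat N} {U : Set ℂ} {WL WR : ℂ → Mat N}

/-- Differentiating `W_R⁻¹` turns right multiplication by `h^R` into left multiplication by `-h^R`,
so the diagonal factor solves one linear equation with entire coefficients over `z²`. -/
theorem IsPearsonFactorization.hasMatDerivAt_left (hF : IsPearsonFactorization γ W hL hR U WL WR)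
    {z : ℂ} (hz : z ∈ U) (hz0 : z ≠ 0) :
    HasMatDerivAt (fun w => Matrix.fromBlocks (WL w) 0 0 (WR w)⁻¹)
      ((z ^ 2)⁻¹ • (Matrix.fromBlocks (hL z) 0 0 (-hR z) *
        Matrix.fromBlocks (WL z) 0 0 (WR z)⁻¹)) z := by
  have hdet := (Matrix.isUnit_iff_isUnit_det _).1 (hF.right_invertible z hz)
  have h1 := (hF.left_holomorphic z hz).hasMatDerivAt
  have h2 := (hF.right_holomorphic z hz).hasMatDerivAt.inv (hF.right_invertible z hz)
  have e1 : matDeriv WL z = (z ^ 2)⁻¹ • (hL z * WL z) :=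
    (eq_inv_smul_iff₀ (pow_ne_zero 2 hz0)).2 (hF.left_pearson z hz)
  have e2 : matDeriv WR z = (z ^ 2)⁻¹ • (WR z * hR z) :=
    (eq_inv_smul_iff₀ (pow_ne_zero 2 hz0)).2 (hF.right_pearson z hz)
  rw [e1] at h1
  rw [e2, mul_smul_comm, smul_mul_assoc, ← mul_assoc, Matrix.nonsing_inv_mul _ hdet, one_mul] at h2
  have := hasMatDerivAt_fromBlocks h1 (hasMatDerivAt_const 0 z) (hasMatDerivAt_const 0 z) h2
  rw [Matrix.fromBlocks_multiply, Matrix.fromBlocks_smul]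
  simpa using this

theorem IsPearsonFactorization.hasMatDerivAt_right (hF : IsPearsonFactorization γ W hL hR U WL WR)
    {z : ℂ} (hz : z ∈ U) (hz0 : z ≠ 0) :
    HasMatDerivAt (fun w => Matrix.fromBlocks (WR w) 0 0 (WL w)⁻¹)
      ((z ^ 2)⁻¹ • (Matrix.fromBlocks (WR z) 0 0 (WL z)⁻¹ *
        Matrix.fromBlocks (hR z) 0 0 (-hL z))) z := by
  have hdet := (Matrix.isUnit_iff_isUnit_det _).1 (hF.left_invertible z hz)
  have h1 := (hF.right_holomorphic z hz).hasMatDerivAt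
  have h2 := (hF.left_holomorphic z hz).hasMatDerivAt.inv (hF.left_invertible z hz)
  have e1 : matDeriv WR z = (z ^ 2)⁻¹ • (WR z * hR z) :=
    (eq_inv_smul_iff₀ (pow_ne_zero 2 hz0)).2 (hF.right_pearson z hz)
  have e2 : matDeriv WL z = (z ^ 2)⁻¹ • (hL z * WL z) :=
    (eq_inv_smul_iff₀ (pow_ne_zero 2 hz0)).2 (hF.left_pearson z hz)
  rw [e1] at h1
  rw [e2, mul_smul_comm, smul_mul_assoc, mul_assoc, mul_assoc, Matrix.mul_nonsing_inv _ hdet,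
    mul_one] at h2
  have := hasMatDerivAt_fromBlocks h1 (hasMatDerivAt_const 0 z) (hasMatDerivAt_const 0 z) h2
  rw [Matrix.fromBlocks_multiply, Matrix.fromBlocks_smul]
  simpa using this

end Structure

end BesselMBP
end

/-! ### Assembly of the left and right statements -/

theorem mainTheorem2 {N : ℕ} (hN : 1 ≤ N) (γ : BesselMBP.OriginLoop) (W : ℂ → BesselMBP.Mat N)
    (hBessel : BesselMBP.IsBesselType γ W) (hReg : BesselMBP.IsRegular γ W)
    (hL hR : ℂ → BesselMBP.Mat N)
    (hL_entire : BesselMBP.MatEntire hL) (hR_entire : BesselMBP.MatEntire hR)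
    (U : Set ℂ) (WL WR : ℂ → BesselMBP.Mat N)
    (hFactor : BesselMBP.IsPearsonFactorization γ W hL hR U WL WR) :
    (∃ (PL PR : ℕ → Polynomial (BesselMBP.Mat N)) (C : ℕ → BesselMBP.Mat N),
      BesselMBP.IsBiorthogonal γ W PL PR C) ∧
    ∀ (PL PR : ℕ → Polynomial (BesselMBP.Mat N)) (C : ℕ → BesselMBP.Mat N),
      BesselMBP.IsBiorthogonal γ W PL PR C →
      ∀ n : ℕ,
        (∀ z ∈ U \ γ.trace,
          (BesselMBP.MatDifferentiableAt
            (BesselMBP.ZL (BesselMBP.YL γ W PL C n) WL WR) z ∧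
            IsUnit (BesselMBP.ZL (BesselMBP.YL γ W PL C n) WL WR z)) ∧
          (BesselMBP.MatDifferentiableAt
            (BesselMBP.ZR (BesselMBP.YR γ W PR C n) WL WR) z ∧
            IsUnit (BesselMBP.ZR (BesselMBP.YR γ W PR C n) WL WR z))) ∧
        BesselMBP.IsMeromorphicWithDoublePole
          (BesselMBP.structureL (BesselMBP.ZL (BesselMBP.YL γ W PL C n) WL WR))
          (U \ γ.trace) ∧
        BesselMBP.IsMeromorphicWithDoublePole
          (BesselMBP.structureR (BesselMBP.ZR (BesselMBP.YR γ W PR C n) WL WR))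
          (U \ γ.trace) := by
  open BesselMBP in
  refine ⟨exists_isBiorthogonal hN hReg, fun PL PR C h n => ?_⟩
  set Y := YL γ W PL C n with hY
  set V := YR γ W PR C n with hV
  obtain ⟨hYd, hXd, E, hE, hEeq⟩ :=
    exists_matEntire_structure_YL PL PR C hReg.1 hL_entire hR_entire hFactor n
  have hinv : ∀ z ∉ γ.trace, Y z * (sympl N * V z * -sympl N) = 1 := fun z hz =>
    h.YL_mul_YR hReg.1 n hz
  have h0 : ∀ z ∉ γ.trace, z ≠ 0 := fun z hz h0 => hz (h0 ▸ γ.zero_mem_trace)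
  -- Undoing the symplectic conjugation carries differentiability and invertibility from `X = Y⁻¹`
  -- to the right matrix.
  have hVX : ∀ z, V z = -sympl N * (sympl N * V z * -sympl N) * sympl N := fun z => by
    rw [mul_assoc, mul_assoc, mul_assoc, neg_mul_sympl, mul_one, ← mul_assoc, neg_mul_sympl,
      one_mul]
  set X : ℂ → BlockMat N := fun z => sympl N * V z * -sympl N with hX
  have hVd : ∀ z ∉ γ.trace, HasMatDerivAt V (-sympl N * matDeriv X z * sympl N) z := fun z hz => by
    have := ((hasMatDerivAt_const (-sympl N) z).mul (hXd z hz).hasMatDerivAt).mul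
      (hasMatDerivAt_const (sympl N) z)
    simp only [zero_mul, mul_zero, zero_add, add_zero] at this
    exact this.congr (Filter.Eventually.of_forall hVX)
  have hYX : ∀ z ∉ γ.trace, matDeriv Y z * X z + Y z * matDeriv X z = 0 := fun z hz =>
    ((hYd z hz).hasMatDerivAt.mul (hXd z hz).hasMatDerivAt).unique
      ((hasMatDerivAt_const 1 z).congr (Filter.mem_of_superset
        (γ.isClosed_trace.isOpen_compl.mem_nhds hz) hinv))
  have hYu : ∀ z ∉ γ.trace, IsUnit (Y z) := fun z hz =>
    IsUnit.of_mul_eq_one _ (hinv z hz)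
  have hJ : ∀ A B : BlockMat N, A * sympl N * (-sympl N * B) = A * B := fun A B => by
    rw [mul_assoc, ← mul_assoc (sympl N), sympl_mul_neg, one_mul]
  have hVinv : ∀ z ∉ γ.trace, (-sympl N * Y z * sympl N) * V z = 1 := fun z hz => by
    rw [hVX, mul_assoc (-sympl N) (X z), hJ, mul_assoc, ← mul_assoc (Y z), hinv z hz, one_mul,
      neg_mul_sympl]
  have hVu : ∀ z ∉ γ.trace, IsUnit (V z) := fun z hz =>
    IsUnit.of_mul_eq_one_right _ (hVinv z hz)
  have hDLu : ∀ z ∈ U, IsUnit (Matrix.fromBlocks (WL z) 0 0 (WR z)⁻¹) := fun z hz =>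
    isUnit_fromBlocks_diag (hFactor.left_invertible z hz)
      ((Matrix.isUnit_nonsing_inv_iff).2 (hFactor.right_invertible z hz))
  have hDRu : ∀ z ∈ U, IsUnit (Matrix.fromBlocks (WR z) 0 0 (WL z)⁻¹) := fun z hz =>
    isUnit_fromBlocks_diag (hFactor.right_invertible z hz)
      ((Matrix.isUnit_nonsing_inv_iff).2 (hFactor.left_invertible z hz))
  have hZL : ∀ z ∈ U \ γ.trace, HasMatDerivAt (ZL Y WL WR) _ z := fun z hz =>
    (hYd z hz.2).hasMatDerivAt.mul (hFactor.hasMatDerivAt_left hz.1 (h0 z hz.2))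
  have hZR : ∀ z ∈ U \ γ.trace, HasMatDerivAt (ZR V WL WR) _ z := fun z hz =>
    (hFactor.hasMatDerivAt_right hz.1 (h0 z hz.2)).mul (hVd z hz.2)
  refine ⟨fun z hz => ⟨⟨(hZL z hz).matDifferentiableAt, (hYu z hz.2).mul (hDLu z hz.1)⟩,
    (hZR z hz).matDifferentiableAt, (hDRu z hz.1).mul (hVu z hz.2)⟩,
    isMeromorphicWithDoublePole_of_matEntire hE (fun h => h.2 γ.zero_mem_trace) fun z hz => ?_,
    -- With `V = -J X J` and `X = Y⁻¹`, the right structure matrix is `J M^L J`, so the same `E`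
    -- serves.
    isMeromorphicWithDoublePole_of_matEntire (E := fun z => sympl N * E z * sympl N)
      (((matEntire_const _).mul hE).mul (matEntire_const _)) (fun h => h.2 γ.zero_mem_trace)
      fun z hz => ?_⟩
  -- The diagonal factor, invertible on `U`, cancels against its inverse and leaves `(z² Y' + Y
  -- diag(h^L, -h^R)) X`.
  · have hz2 : z ^ 2 ≠ 0 := pow_ne_zero 2 (h0 z hz.2)
    have hD := Matrix.mul_nonsing_inv _ ((Matrix.isUnit_iff_isUnit_det _).1 (hDLu z hz.1))
    rw [structureL, (hZL z hz).matDeriv, ZL, Matrix.mul_inv_rev,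
      Matrix.inv_eq_right_inv (hinv z hz.2), ← hEeq z hz.2, ← smul_mul_assoc, smul_add,
      mul_smul_comm, smul_inv_smul₀ hz2, ← mul_assoc (Y z), ← smul_mul_assoc, ← add_mul, mul_assoc,
      ← mul_assoc _ _ (sympl N * V z * -sympl N), hD, one_mul]
  · have hz2 : z ^ 2 ≠ 0 := pow_ne_zero 2 (h0 z hz.2)
    have hD := Matrix.nonsing_inv_mul _ ((Matrix.isUnit_iff_isUnit_det _).1 (hDRu z hz.1))
    have hH : Matrix.fromBlocks (hR z) 0 0 (-hL z) =
        -sympl N * -Matrix.fromBlocks (hL z) 0 0 (-hR z) * sympl N := by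
      rw [neg_mul_neg, ← neg_neg (sympl N * _ * sympl N), ← mul_neg, sympl_conj,
        Matrix.fromBlocks_neg]
      simp only [neg_neg, neg_zero]
    have hV' : V z = -sympl N * (X z * sympl N) := by rw [← mul_assoc]; exact hVX z
    have hstep : z ^ 2 • (-sympl N * Y z * sympl N * (Matrix.fromBlocks (WR z) 0 0 (WL z)⁻¹)⁻¹ *
        (((z ^ 2)⁻¹ • (Matrix.fromBlocks (WR z) 0 0 (WL z)⁻¹ *
          Matrix.fromBlocks (hR z) 0 0 (-hL z))) * V z +
        Matrix.fromBlocks (WR z) 0 0 (WL z)⁻¹ * (-sympl N * matDeriv X z * sympl N))) =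
        -sympl N * Y z * sympl N * (Matrix.fromBlocks (hR z) 0 0 (-hL z) * V z +
          z ^ 2 • (-sympl N * (matDeriv X z * sympl N))) := by
      rw [smul_mul_assoc, mul_assoc _ _ (V z), mul_assoc (-sympl N * Y z * sympl N),
        mul_add (Matrix.fromBlocks (WR z) 0 0 (WL z)⁻¹)⁻¹, mul_smul_comm, ← mul_assoc _ _ (_ * V z),
        ← mul_assoc _ _ (-sympl N * _ * _), hD, one_mul, one_mul, ← mul_smul_comm, smul_add,
        smul_inv_smul₀ hz2, mul_assoc (-sympl N) (matDeriv X z)]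
    rw [structureR, (hZR z hz).matDeriv, ZR, Matrix.mul_inv_rev,
      Matrix.inv_eq_left_inv (hVinv z hz.2), ← hEeq z hz.2, hstep, hH, mul_add, mul_smul_comm, hJ,
      hV', hJ, mul_assoc (-sympl N) (-Matrix.fromBlocks _ _ _ _), hJ]
    -- Differentiating `Y X = 1` trades `Y X'` for `-Y' X`, which brings the right expression to the
    -- form of the left one.
    have h1 : Y z * (matDeriv X z * sympl N) = -(matDeriv Y z * X z * sympl N) := by
      rw [← mul_assoc, eq_neg_of_add_eq_zero_right (hYX z hz.2), neg_mul]
    rw [mul_assoc (-sympl N) (Y z) (matDeriv X z * _), h1]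
    change _ = sympl N * ((z ^ 2 • matDeriv Y z + Y z * _) * X z) * sympl N
    simp only [mul_assoc, add_mul, mul_add, neg_mul, mul_neg, neg_neg, smul_mul_assoc, mul_smul_comm]
    abel
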